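/- Theorem (local flatness of $T^1_1(M)$). Let $(M,g)$ be a smooth ($C^\infty$) Riemannian manifold of finite dimension $n$, with Levi-Civita connection $\nabla$ and Christoffel symbols $\Gamma^h_{ij}$, and let $f\in C^\infty(M)$ with $f>0$. Let $T^1_1(M)$ be the bundle of $(1,1)$-tensors of $M$, a smooth manifold of dimension $n+n^2$ with the local coordinates $(x^j,t^i_j)$ induced by local coordinates $(x^j)$ of $M$. For a vector $X$ and a $(1,1)$-tensor $A$ at $x\in M$, let ${}^HX$ and ${}^VA$ be the horizontal and vertical lifts at a point $(x,t)$ of $T^1_1(M)$, whose components in the coordinates $(x^j,t^i_j)$ are $\big(X^j,\;X^s(\Gamma^m_{sj}t^i_m-\Gamma^i_{sm}t^m_j)\big)$ and $\big(0,\;A^i_j\big)$ respectively. The rescaled Sasaki type metric ${}^Sg_f$ on $T^1_1(M)$ is determined by $${}^Sg_f({}^HX,{}^HY)=f\,g(X,Y),\qquad {}^Sg_f({}^VA,{}^HY)=0,\qquad {}^Sg_f({}^VA,{}^VB)=g_{it}\,g^{jl}A^i_jB^t_l .$$ Let $A^h_{ji}=f_j\delta^h_i+f_i\delta^h_j-f^h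 g_{ji}$ be the $(1,2)$-tensor field on $M$ with $f_i=\partial_i f$ and $f^h=g^{hk}f_k$. A Riemannian manifold is called locally flat if its Riemann curvature tensor vanishes identically. Then $(T^1_1(M),{}^Sg_f)$ is locally flat if and only if $(M,g)$ is locally flat and $$\nabla_m\Big(\frac1{2f}A^r_{lj}\Big)-\nabla_l\Big(\frac1{2f}A^r_{mj}\Big)+\frac1{4f^2}\big(A^r_{ms}A^s_{lj}-A^r_{ls}A^s_{mj}\big)=0$$ everywhere on $M$. Consequently, if $f$ is constant, then $(T^1_1(M),{}^Sg_f)$ is locally flat if and only if $(M,g)$ is locally flat. -/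

import Mathlib

open scoped Manifold ContDiff

set_option maxSynthPendingDepth 3

noncomputable section

namespace RescaledSasaki

/-! ### Levi-Civita connection and curvature in local coordinates

`V` is the finite-dimensional coordinate space, and `G : V → V →L[ℝ] V →L[ℝ] ℝ` is the coordinate
expression `y ↦ (g_{ij}(y))` of a Riemannian metric, on an open subset of `V`. -/

section Coordinates

variable {V : Type*} [NormedAddCommGroup V] [NormedSpace ℝ V]

/-- Raising an index with a bilinear form `b`: for nondegenerate `b` on a finite-dimensional space,
`sharp b φ` is the vector with `b (sharp b φ) w = φ w` for all `w`, i.e. `φ^h = g^{hk} φ_k`. -/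
def sharp (b : V →L[ℝ] V →L[ℝ] ℝ) : (V →L[ℝ] ℝ) →L[ℝ] V :=
  ContinuousLinearMap.inverse b

/-- Twice the Christoffel symbols of the first kind:
`(u, v, w) ↦ (∂_u G)(v, w) + (∂_v G)(u, w) - (∂_w G)(u, v)`. -/
def christoffelLower (G : V → V →L[ℝ] V →L[ℝ] ℝ) (y : V) : V →L[ℝ] V →L[ℝ] V →L[ℝ] ℝ :=
  fderiv ℝ G y + (fderiv ℝ G y).flip
    - (ContinuousLinearMap.flipₗᵢ ℝ V V ℝ).toContinuousLinearEquiv.toContinuousLinearMap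
        ∘L (fderiv ℝ G y).flip

theorem christoffelLower_apply (G : V → V →L[ℝ] V →L[ℝ] ℝ) (y u v w : V) :
    christoffelLower G y u v w =
      fderiv ℝ G y u v w + fderiv ℝ G y v u w - fderiv ℝ G y w u v := rfl

/-- The Christoffel symbols `Γ^h_{ij}` of the Levi-Civita connection, as the bilinear map
`(u, v) ↦ Γ^h_{ij} u^i v^j`, characterized by
`2 G(Γ(u, v), w) = (∂_u G)(v, w) + (∂_v G)(u, w) - (∂_w G)(u, v)`. -/
def christoffel (G : V → V →L[ℝ] V →L[ℝ] ℝ) (y : V) : V →L[ℝ] V →L[ℝ] V :=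
  (1 / 2 : ℝ) •
    (ContinuousLinearMap.compL ℝ V (V →L[ℝ] ℝ) V (sharp (G y)) ∘L christoffelLower G y)

theorem christoffel_apply (G : V → V →L[ℝ] V →L[ℝ] ℝ) (y u v : V) :
    christoffel G y u v = (1 / 2 : ℝ) • sharp (G y) (christoffelLower G y u v) := rfl

/-- The Riemann curvature tensor `R(u, v) w` of the Levi-Civita connection, for
`R(X, Y) = [∇_X, ∇_Y] - ∇_{[X, Y]}`, in coordinates. -/
def coordCurvature (G : V → V →L[ℝ] V →L[ℝ] ℝ) (y u v w : V) : V :=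
  fderiv ℝ (fun z => christoffel G z v w) y u - fderiv ℝ (fun z => christoffel G z u w) y v
    + christoffel G y u (christoffel G y v w) - christoffel G y v (christoffel G y u w)

/-- The covariant derivative `(∇_m S)(l, j)` of a tensor field `S` of type `(1,2)`, in
coordinates. -/
def coordCovDeriv (G : V → V →L[ℝ] V →L[ℝ] ℝ) (S : V → V → V → V) (y m l j : V) : V :=
  fderiv ℝ (fun z => S z l j) y m + christoffel G y m (S y l j)
    - S y (christoffel G y m l) j - S y l (christoffel G y m j)

/-- The tensor field `A^h_{ji} = f_j δ^h_i + f_i δ^h_j - f^h g_{ji}`, where `f_i = ∂_i f` and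
`f^h = g^{hk} f_k`; `φ` is the coordinate expression of `f`. -/
def coordA (G : V → V →L[ℝ] V →L[ℝ] ℝ) (φ : V → ℝ) (y u v : V) : V :=
  fderiv ℝ φ y u • v + fderiv ℝ φ y v • u - G y u v • sharp (G y) (fderiv ℝ φ y)

/-- The tensor field
`∇_m (A^r_{lj} / (2f)) - ∇_l (A^r_{mj} / (2f)) + (A^r_{ms} A^s_{lj} - A^r_{ls} A^s_{mj}) / (4f²)`
in coordinates. -/
def coordObstruction (G : V → V →L[ℝ] V →L[ℝ] ℝ) (φ : V → ℝ) (y m l j : V) : V :=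
  coordCovDeriv G (fun z u v => (1 / (2 * φ z)) • coordA G φ z u v) y m l j
    - coordCovDeriv G (fun z u v => (1 / (2 * φ z)) • coordA G φ z u v) y l m j
    + (1 / (4 * φ y ^ 2)) •
        (coordA G φ y m (coordA G φ y l j) - coordA G φ y l (coordA G φ y m j))

end Coordinates

/-! ### Metrics on manifolds without boundary -/

section Manifolds

variable {V : Type*} [NormedAddCommGroup V] [NormedSpace ℝ V]
  {H : Type*} [TopologicalSpace H] (I : ModelWithCorners ℝ V H)
  {N : Type*} [TopologicalSpace N] [ChartedSpace H N]

/-- The coordinate expression, in the chart around `p`, of a field of bilinear forms on the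
tangent spaces. -/
def metricInChart (h : ∀ q : N, TangentSpace I q →L[ℝ] TangentSpace I q →L[ℝ] ℝ) (p : N) (y : V) :
    V →L[ℝ] V →L[ℝ] ℝ :=
  let b : V →L[ℝ] V →L[ℝ] ℝ := h ((extChartAt I p).symm y)
  let D : V →L[ℝ] V := mfderiv 𝓘(ℝ, V) I (extChartAt I p).symm y
  b.bilinearComp D D

theorem metricInChart_apply (h : ∀ q : N, TangentSpace I q →L[ℝ] TangentSpace I q →L[ℝ] ℝ) (p : N)
    (y v w : V) :
    metricInChart I h p y v w = h ((extChartAt I p).symm y)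
      (mfderiv 𝓘(ℝ, V) I (extChartAt I p).symm y v)
      (mfderiv 𝓘(ℝ, V) I (extChartAt I p).symm y w) := rfl

/-- The metric `h` is locally flat: its Riemann curvature tensor vanishes identically. -/
def IsLocallyFlat (h : ∀ q : N, TangentSpace I q →L[ℝ] TangentSpace I q →L[ℝ] ℝ) : Prop :=
  ∀ p : N, ∀ y ∈ (extChartAt I p).target, ∀ u v w : V,
    coordCurvature (metricInChart I h p) y u v w = 0

/-- The identity
`∇_m (A^r_{lj} / (2f)) - ∇_l (A^r_{mj} / (2f)) + (A^r_{ms} A^s_{lj} - A^r_{ls} A^s_{mj}) / (4f²) = 0`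
on the manifold, for the Levi-Civita connection of `h`. -/
def ObstructionVanishes (h : ∀ q : N, TangentSpace I q →L[ℝ] TangentSpace I q →L[ℝ] ℝ)
    (f : N → ℝ) : Prop :=
  ∀ p : N, ∀ y ∈ (extChartAt I p).target, ∀ m l j : V,
    coordObstruction (metricInChart I h p) (fun z => f ((extChartAt I p).symm z)) y m l j = 0

end Manifolds

/-! ### The rescaled Sasaki type metric at a point, in coordinates

A tangent vector of the `(1,1)`-tensor bundle at `(x, t)` has coordinates `(X, B)`, with
`X = (X^j)` and `B = (B^i_j)`, with respect to the natural frame of the coordinates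
`(x^j, t^i_j)`. `Γ` denotes the Christoffel symbols at `x`. -/

section Lifts

variable {V : Type*} [NormedAddCommGroup V] [NormedSpace ℝ V]

/-- The vertical lift `^V A = (0, A)`. -/
def verticalLift (A : V →L[ℝ] V) : V × (V →L[ℝ] V) := (0, A)

/-- The horizontal lift `^H X` at `t`, with fibre component
`X^s (Γ^m_{sj} t^i_m - Γ^i_{sm} t^m_j)`. -/
def horizontalLift (Γ : V →L[ℝ] V →L[ℝ] V) (t : V →L[ℝ] V) (X : V) : V × (V →L[ℝ] V) :=
  (X, t ∘L Γ X - Γ X ∘L t)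

/-- The vertical part of a tangent vector at `t`: a vector `(X, B)` is the sum of `^H X` and `^V A`
with `A = B + Γ(X) ∘ t - t ∘ Γ(X)`. -/
def verticalPart (Γ : V →L[ℝ] V →L[ℝ] V) (t : V →L[ℝ] V) : V × (V →L[ℝ] V) →L[ℝ] (V →L[ℝ] V) :=
  ContinuousLinearMap.snd ℝ V (V →L[ℝ] V)
    + ((ContinuousLinearMap.compL ℝ V V V).flip t - ContinuousLinearMap.compL ℝ V V V t)
        ∘L Γ ∘L ContinuousLinearMap.fst ℝ V (V →L[ℝ] V)

theorem verticalPart_apply (Γ : V →L[ℝ] V →L[ℝ] V) (t : V →L[ℝ] V) (ξ : V × (V →L[ℝ] V)) :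
    verticalPart Γ t ξ = ξ.2 + (Γ ξ.1 ∘L t - t ∘L Γ ξ.1) := rfl

theorem horizontalLift_add_verticalLift (Γ : V →L[ℝ] V →L[ℝ] V) (t : V →L[ℝ] V)
    (ξ : V × (V →L[ℝ] V)) :
    horizontalLift Γ t ξ.1 + verticalLift (verticalPart Γ t ξ) = ξ := by
  refine Prod.ext ?_ ?_
  · simp [horizontalLift, verticalLift]
  · simp only [horizontalLift, verticalLift, verticalPart_apply, Prod.snd_add]
    abel

theorem verticalPart_verticalLift (Γ : V →L[ℝ] V →L[ℝ] V) (t A : V →L[ℝ] V) :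
    verticalPart Γ t (verticalLift A) = A := by
  simp [verticalPart_apply, verticalLift]

theorem verticalPart_horizontalLift (Γ : V →L[ℝ] V →L[ℝ] V) (t : V →L[ℝ] V) (X : V) :
    verticalPart Γ t (horizontalLift Γ t X) = 0 := by
  simp [verticalPart_apply, horizontalLift]

end Lifts

section Sasaki

variable {n : ℕ}

/-- The inner product on `(1,1)`-tensors at a point induced by `b = (g_{ij})`:
`G(A, B) = g_{it} g^{jl} A^i_j B^t_l`. Here `sharp b (dx^l)` has components `g^{jl}`. -/
def tensorInner (b : EuclideanSpace ℝ (Fin n) →L[ℝ] EuclideanSpace ℝ (Fin n) →L[ℝ] ℝ) :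
    (EuclideanSpace ℝ (Fin n) →L[ℝ] EuclideanSpace ℝ (Fin n)) →L[ℝ]
      (EuclideanSpace ℝ (Fin n) →L[ℝ] EuclideanSpace ℝ (Fin n)) →L[ℝ] ℝ :=
  ∑ j : Fin n, ∑ l : Fin n, (sharp b (EuclideanSpace.proj l) j) •
    b.bilinearComp
      (ContinuousLinearMap.apply ℝ (EuclideanSpace ℝ (Fin n)) (EuclideanSpace.single j (1 : ℝ)))
      (ContinuousLinearMap.apply ℝ (EuclideanSpace ℝ (Fin n)) (EuclideanSpace.single l (1 : ℝ)))

theorem tensorInner_apply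
    (b : EuclideanSpace ℝ (Fin n) →L[ℝ] EuclideanSpace ℝ (Fin n) →L[ℝ] ℝ)
    (A B : EuclideanSpace ℝ (Fin n) →L[ℝ] EuclideanSpace ℝ (Fin n)) :
    tensorInner b A B = ∑ j : Fin n, ∑ l : Fin n, sharp b (EuclideanSpace.proj l) j *
      b (A (EuclideanSpace.single j 1)) (B (EuclideanSpace.single l 1)) := by
  simp [tensorInner]

/-- The bilinear form for which horizontal and vertical vectors are orthogonal, the product of
`^H X` and `^H Y` is `c * b(X, Y)`, and the product of `^V A` and `^V B` is `G(A, B)`. -/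
def sasakiForm (b : EuclideanSpace ℝ (Fin n) →L[ℝ] EuclideanSpace ℝ (Fin n) →L[ℝ] ℝ) (c : ℝ)
    (Γ : EuclideanSpace ℝ (Fin n) →L[ℝ] EuclideanSpace ℝ (Fin n) →L[ℝ] EuclideanSpace ℝ (Fin n))
    (t : EuclideanSpace ℝ (Fin n) →L[ℝ] EuclideanSpace ℝ (Fin n)) :
    EuclideanSpace ℝ (Fin n) × (EuclideanSpace ℝ (Fin n) →L[ℝ] EuclideanSpace ℝ (Fin n)) →L[ℝ]
      EuclideanSpace ℝ (Fin n) × (EuclideanSpace ℝ (Fin n) →L[ℝ] EuclideanSpace ℝ (Fin n)) →L[ℝ]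
        ℝ :=
  c • b.bilinearComp (ContinuousLinearMap.fst ℝ _ _) (ContinuousLinearMap.fst ℝ _ _)
    + (tensorInner b).bilinearComp (verticalPart Γ t) (verticalPart Γ t)

variable (b : EuclideanSpace ℝ (Fin n) →L[ℝ] EuclideanSpace ℝ (Fin n) →L[ℝ] ℝ) (c : ℝ)
  (Γ : EuclideanSpace ℝ (Fin n) →L[ℝ] EuclideanSpace ℝ (Fin n) →L[ℝ] EuclideanSpace ℝ (Fin n))
  (t A B : EuclideanSpace ℝ (Fin n) →L[ℝ] EuclideanSpace ℝ (Fin n))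
  (X Y : EuclideanSpace ℝ (Fin n))

theorem sasakiForm_apply
    (ξ η : EuclideanSpace ℝ (Fin n) × (EuclideanSpace ℝ (Fin n) →L[ℝ] EuclideanSpace ℝ (Fin n))) :
    sasakiForm b c Γ t ξ η =
      c * b ξ.1 η.1 + tensorInner b (verticalPart Γ t ξ) (verticalPart Γ t η) := rfl

theorem sasakiForm_vertical_vertical :
    sasakiForm b c Γ t (verticalLift A) (verticalLift B) = tensorInner b A B := by
  rw [sasakiForm_apply, verticalPart_verticalLift, verticalPart_verticalLift]
  simp [verticalLift]

theorem sasakiForm_vertical_horizontal :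
    sasakiForm b c Γ t (verticalLift A) (horizontalLift Γ t Y) = 0 := by
  rw [sasakiForm_apply, verticalPart_verticalLift, verticalPart_horizontalLift]
  simp [verticalLift]

theorem sasakiForm_horizontal_vertical :
    sasakiForm b c Γ t (horizontalLift Γ t X) (verticalLift B) = 0 := by
  rw [sasakiForm_apply, verticalPart_verticalLift, verticalPart_horizontalLift]
  simp [verticalLift]

theorem sasakiForm_horizontal_horizontal :
    sasakiForm b c Γ t (horizontalLift Γ t X) (horizontalLift Γ t Y) = c * b X Y := by
  rw [sasakiForm_apply, verticalPart_horizontalLift, verticalPart_horizontalLift]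
  simp [horizontalLift]

end Sasaki

/-! ### The `(1,1)`-tensor bundle and the rescaled Sasaki type metric -/

section TensorBundle

/-- The bundle `T^1_1(M)` of tensors of type `(1,1)`, as the bundle of endomorphisms of the
tangent spaces. Its chart around `(x, t)` consists of the coordinates `(x^j, t^i_j)` induced by the
chart of `M` around `x`. -/
abbrev T11 (n : ℕ) (M : Type*) [TopologicalSpace M] [ChartedSpace (EuclideanSpace ℝ (Fin n)) M]
    [IsManifold (𝓡 n) ∞ M] :=
  Bundle.TotalSpace (EuclideanSpace ℝ (Fin n) →L[ℝ] EuclideanSpace ℝ (Fin n))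
    (fun x : M => TangentSpace (𝓡 n) x →L[ℝ] TangentSpace (𝓡 n) x)

/-- The model with corners (without boundary) of `T^1_1(M)`. -/
abbrev T11Model (n : ℕ) :=
  (𝓡 n).prod 𝓘(ℝ, EuclideanSpace ℝ (Fin n) →L[ℝ] EuclideanSpace ℝ (Fin n))

variable {n : ℕ} {M : Type*} [TopologicalSpace M] [ChartedSpace (EuclideanSpace ℝ (Fin n)) M]
  [IsManifold (𝓡 n) ∞ M]

/-- The Christoffel symbols at `x` in the chart around `x`. -/
def christoffelAt (g : ∀ x : M, TangentSpace (𝓡 n) x →L[ℝ] TangentSpace (𝓡 n) x →L[ℝ] ℝ) (x : M) :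
    EuclideanSpace ℝ (Fin n) →L[ℝ] EuclideanSpace ℝ (Fin n) →L[ℝ] EuclideanSpace ℝ (Fin n) :=
  christoffel (metricInChart (𝓡 n) g x) (extChartAt (𝓡 n) x x)

/-- The rescaled Sasaki type metric `^S g_f` on `T^1_1(M)`, with
`^S g_f(^H X, ^H Y) = f g(X, Y)`, `^S g_f(^V A, ^H Y) = 0` and `^S g_f(^V A, ^V B) = G(A, B)`.
Tangent vectors at `q = (x, t)` are given by their coordinates in the chart around `q`, which is
the one induced by the chart of `M` around `x`. -/
def sasaki (g : ∀ x : M, TangentSpace (𝓡 n) x →L[ℝ] TangentSpace (𝓡 n) x →L[ℝ] ℝ) (f : M → ℝ)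
    (q : T11 n M) :
    TangentSpace (T11Model n) q →L[ℝ] TangentSpace (T11Model n) q →L[ℝ] ℝ :=
  sasakiForm (g q.1) (f q.1) (christoffelAt g q.1) q.2

end TensorBundle

end RescaledSasaki

end

/-! Let `K` be the projection of a tangent vector of the tensor bundle onto its vertical part
(`verticalField`). In induced coordinates the metric is `f g(ξ₁, η₁) + ⟨Kξ, Kη⟩`, with `⟨ , ⟩` the
inner product of `(1,1)`-tensors. It has a natural metric connection, a direct sum: on horizontal
parts the Levi-Civita connection of the conformal metric `f g`, on vertical parts the pullback of
`∇` (`sasakiChristoffel`, `fderiv_coordSasaki`). Its torsion at `(x, t)` is vertical and equals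
`[R(u, v), t]`, so it is the Levi-Civita connection wherever the curvature operators of `g` commute
with `t` (`christoffel_coordSasaki`).

The curvature of this direct sum (`curvature_sasakiChristoffel`) consists of the curvature of `f g`
and of the commutator with `R(u, v)` on vertical parts. Since `f g` has the symbols `Γ + A / (2f)`,
its curvature is `R` plus the obstruction of the theorem (`conformalCurvature`).

If `R` and the obstruction vanish, the direct sum is the Levi-Civita connection everywhere, and it
is flat. Conversely, `[R(u, v), t] = 0` holds on the zero section `t = 0`, and curvature in
directions tangent to the zero section only involves the symbols along it. Flatness therefore gives
`R + obstruction = 0` and `[R(u, v), C] = 0` for every endomorphism `C`. A skew operator commuting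
with all endomorphisms is zero (`curvatureOp_eq_zero_of_commute`), so both tensors vanish.

It remains to pass from charts to the manifold. The metric is given at each point in the chart
around that point; the transformation law of the Christoffel symbols shows that a single bundle
chart sees the expected expression throughout (`metricInChart_sasaki`). -/

noncomputable section

open scoped Topology

namespace RescaledSasaki

/-! ### Levi-Civita symbols of a nondegenerate form in coordinates -/

section General

variable {W : Type*} [NormedAddCommGroup W] [NormedSpace ℝ W]

theorem isInvertible_of_injective [FiniteDimensional ℝ W] {b : W →L[ℝ] W →L[ℝ] ℝ}
    (hb : Function.Injective b) :
    b.IsInvertible := by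
  have hfin : Module.finrank ℝ W = Module.finrank ℝ (W →L[ℝ] ℝ) := by
    rw [← LinearMap.toContinuousLinearMap.finrank_eq]
    exact (Subspace.dual_finrank_eq).symm
  refine ⟨(LinearEquiv.ofInjectiveOfFinrankEq b.toLinearMap hb hfin).toContinuousLinearEquiv, ?_⟩
  ext; rfl

theorem injective_of_nondegenerate {b : W →L[ℝ] W →L[ℝ] ℝ} (hb : ∀ v, (∀ w, b v w = 0) → v = 0) :
    Function.Injective b := by
  refine (injective_iff_map_eq_zero b).2 fun v hv => hb v fun w => by simp [hv]

theorem injective_of_pos {b : W →L[ℝ] W →L[ℝ] ℝ} (hb : ∀ v, v ≠ 0 → 0 < b v v) :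
    Function.Injective b := by
  refine injective_of_nondegenerate fun v hv => ?_
  by_contra h
  exact (hb v h).ne' (hv v)

theorem apply_sharp {b : W →L[ℝ] W →L[ℝ] ℝ} (hb : b.IsInvertible) (φ : W →L[ℝ] ℝ) :
    b (sharp b φ) = φ := hb.self_apply_inverse φ

theorem sharp_apply {b : W →L[ℝ] W →L[ℝ] ℝ} (hb : b.IsInvertible) (v : W) :
    sharp b (b v) = v := hb.inverse_apply_self v

theorem contDiffAt_sharp [FiniteDimensional ℝ W] {X : Type*} [NormedAddCommGroup X]
    [NormedSpace ℝ X] {n : ℕ∞ω}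
    {F : X → W →L[ℝ] W →L[ℝ] ℝ} {y : X} (hF : ContDiffAt ℝ n F y) (hb : (F y).IsInvertible) :
    ContDiffAt ℝ n (fun z => sharp (F z)) y := by
  obtain ⟨e, he⟩ := hb
  have : CompleteSpace W := FiniteDimensional.complete ℝ W
  have h := contDiffAt_map_inverse (𝕜 := ℝ) (n := n) e
  rw [he] at h
  exact h.comp y hF

theorem contDiffAt_flip {X Y Z Z' : Type*} [NormedAddCommGroup X] [NormedSpace ℝ X]
    [NormedAddCommGroup Y] [NormedSpace ℝ Y] [NormedAddCommGroup Z] [NormedSpace ℝ Z]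
    [NormedAddCommGroup Z'] [NormedSpace ℝ Z'] {k : ℕ∞ω} {B : X → Y →L[ℝ] Z →L[ℝ] Z'} {x : X}
    (hB : ContDiffAt ℝ k B x) : ContDiffAt ℝ k (fun z => (B z).flip) x :=
  (ContinuousLinearMap.flipₗᵢ ℝ Y Z Z').toContinuousLinearEquiv.contDiff.contDiffAt.comp x hB

theorem contDiffAt_bilinearComp {X Y Z : Type*} [NormedAddCommGroup X] [NormedSpace ℝ X]
    [NormedAddCommGroup Y] [NormedSpace ℝ Y] [NormedAddCommGroup Z] [NormedSpace ℝ Z] {k : ℕ∞ω}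
    {B : X → Y →L[ℝ] Y →L[ℝ] ℝ} {D : X → Z →L[ℝ] Y} {x : X} (hB : ContDiffAt ℝ k B x)
    (hD : ContDiffAt ℝ k D x) : ContDiffAt ℝ k (fun z => (B z).bilinearComp (D z) (D z)) x :=
  contDiffAt_flip ((contDiffAt_flip (hB.clm_comp hD)).clm_comp hD)

variable {F : W → W →L[ℝ] W →L[ℝ] ℝ} {y : W}

/-- The Christoffel symbols are the only symmetric symbols for which the metric is parallel. -/
theorem christoffel_eq (hF : (F y).IsInvertible) (hsymm : ∀ v w, F y v w = F y w v)
    {T : W → W → W} (hT : ∀ u v, T u v = T v u)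
    (hcompat : ∀ u v w, fderiv ℝ F y u v w = F y (T u v) w + F y v (T u w)) (u v : W) :
    christoffel F y u v = T u v := by
  rw [← sharp_apply hF (T u v), christoffel_apply, ← map_smul]
  congr 1
  ext w
  simp only [christoffelLower_apply, hcompat, smul_apply, smul_eq_mul]
  rw [hT v u, hT w u, hT w v, hsymm v, hsymm (T u w) v]
  ring

theorem fderiv_form_symm (hd : DifferentiableAt ℝ F y)
    (hsymm : ∀ᶠ z in 𝓝 y, ∀ v w, F z v w = F z w v) (u v w : W) :
    fderiv ℝ F y u v w = fderiv ℝ F y u w v := by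
  have h1 : HasFDerivAt (fun z => F z v w) _ y :=
    (hd.hasFDerivAt.clm_apply (hasFDerivAt_const v y)).clm_apply (hasFDerivAt_const w y)
  have h2 : HasFDerivAt (fun z => F z w v) _ y :=
    (hd.hasFDerivAt.clm_apply (hasFDerivAt_const w y)).clm_apply (hasFDerivAt_const v y)
  have h3 := h1.congr_of_eventuallyEq
    (show (fun z => F z w v) =ᶠ[𝓝 y] fun z => F z v w from hsymm.mono fun z hz => hz w v)
  have := congrArg (fun L => L u) (h3.unique h2)
  simpa using this

theorem christoffel_symm (hd : DifferentiableAt ℝ F y)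
    (hsymm : ∀ᶠ z in 𝓝 y, ∀ v w, F z v w = F z w v) (u v : W) :
    christoffel F y u v = christoffel F y v u := by
  rw [christoffel_apply, christoffel_apply]
  congr 2
  ext w
  rw [christoffelLower_apply, christoffelLower_apply, fderiv_form_symm hd hsymm w u v]
  ring

/-- Converse of `christoffel_eq`: in the sum of the two Koszul formulas all derivatives cancel
except those in the direction `u`. -/
theorem fderiv_form_eq (hF : (F y).IsInvertible) (hd : DifferentiableAt ℝ F y)
    (hsymm : ∀ᶠ z in 𝓝 y, ∀ v w, F z v w = F z w v) (u v w : W) :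
    fderiv ℝ F y u v w = F y (christoffel F y u v) w + F y v (christoffel F y u w) := by
  rw [hsymm.self_of_nhds v]
  simp only [christoffel_apply, map_smul, apply_sharp hF, smul_apply,
    christoffelLower_apply, smul_eq_mul]
  rw [fderiv_form_symm hd hsymm u w v, fderiv_form_symm hd hsymm v u w,
    fderiv_form_symm hd hsymm w u v]
  ring

theorem contDiffAt_christoffel [FiniteDimensional ℝ W] (hF : (F y).IsInvertible)
    (hd : ContDiffAt ℝ ∞ F y) :
    ContDiffAt ℝ ∞ (christoffel F) y := by
  have h1 : ContDiffAt ℝ ∞ (fderiv ℝ F) y := hd.fderiv_right (by simp)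
  have h2 := contDiffAt_sharp hd hF
  have h4 : ContDiffAt ℝ ∞ (christoffelLower F) y :=
    (h1.add (contDiffAt_flip h1)).sub (contDiffAt_const.clm_comp (contDiffAt_flip h1))
  have h5 : ContDiffAt ℝ ∞
      (fun z => ContinuousLinearMap.compL ℝ W (W →L[ℝ] ℝ) W (sharp (F z))) y :=
    (ContinuousLinearMap.compL ℝ W (W →L[ℝ] ℝ) W).contDiff.contDiffAt.comp y h2
  exact (h5.clm_comp h4).const_smul (1 / 2 : ℝ)

/-- Transformation of the Christoffel symbols under a change of coordinates. -/
theorem christoffel_changeOfCoordinates [FiniteDimensional ℝ W] {ψ : W → W}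
    {F' : W → W →L[ℝ] W →L[ℝ] ℝ}
    (hψ : ContDiffAt ℝ 2 ψ y) (hinj : Function.Injective (fderiv ℝ ψ y))
    (hF : (F' (ψ y)).IsInvertible) (hd1 : ContDiffAt ℝ 1 F' (ψ y))
    (hsymm : ∀ᶠ z in 𝓝 (ψ y), ∀ v w, F' z v w = F' z w v)
    (hFF' : ∀ᶠ z in 𝓝 y, F z = (F' (ψ z)).bilinearComp (fderiv ℝ ψ z) (fderiv ℝ ψ z)) (u v : W) :
    fderiv ℝ ψ y (christoffel F y u v) = fderiv ℝ (fderiv ℝ ψ) y u v +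
      christoffel F' (ψ y) (fderiv ℝ ψ y u) (fderiv ℝ ψ y v) := by
  have hd := hd1.differentiableAt one_ne_zero
  let e : W ≃ₗ[ℝ] W := LinearEquiv.ofInjectiveEndo (fderiv ℝ ψ y).toLinearMap hinj
  have he : ∀ x, fderiv ℝ ψ y (e.symm x) = x := fun x => e.apply_symm_apply x
  -- The pullback of the connection of `F'` by `ψ`. It is symmetric and makes `F` parallel, so
  -- uniqueness of the Levi-Civita symbols identifies it.
  let T : W → W → W := fun u v => e.symm (fderiv ℝ (fderiv ℝ ψ) y u v +
      christoffel F' (ψ y) (fderiv ℝ ψ y u) (fderiv ℝ ψ y v))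
  suffices h : christoffel F y u v = T u v by rw [h, he]
  have hFy : F y = _ := hFF'.self_of_nhds
  have h1 : ContDiffAt ℝ 1 (fderiv ℝ ψ) y := hψ.fderiv_right (by norm_num)
  have h2 : DifferentiableAt ℝ (fderiv ℝ ψ) y := h1.differentiableAt one_ne_zero
  refine christoffel_eq (isInvertible_of_injective (injective_of_nondegenerate fun v hv => ?_))
    (fun v w => ?_) (fun u v => ?_) (fun u v w => ?_) u v
  · simp only [hFy, ContinuousLinearMap.bilinearComp_apply] at hv
    refine hinj ?_
    rw [map_zero]
    have : F' (ψ y) (fderiv ℝ ψ y v) = 0 := by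
      ext w
      rw [← he w, hv]; rfl
    rw [← sharp_apply hF (fderiv ℝ ψ y v), this, map_zero]
  · simp only [hFy, ContinuousLinearMap.bilinearComp_apply]
    exact hsymm.self_of_nhds _ _
  · have hs := hψ.isSymmSndFDerivAt (by simp)
    simp only [T]
    rw [hs.eq, christoffel_symm hd hsymm]
  · have hψd : HasFDerivAt ψ (fderiv ℝ ψ y) y := (hψ.differentiableAt (by norm_num)).hasFDerivAt
    have hD : ∀ v, HasFDerivAt (fun z => fderiv ℝ ψ z v) _ y := fun v =>
      h2.hasFDerivAt.clm_apply (hasFDerivAt_const v y)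
    have hF'd : HasFDerivAt (fun z => F' (ψ z)) _ y := hd.hasFDerivAt.comp y hψd
    have h3 := (hF'd.clm_apply (hD v)).clm_apply (hD w)
    have hFd : DifferentiableAt ℝ F y :=
      ((contDiffAt_bilinearComp (hd1.comp y (hψ.of_le (by norm_num))) h1).congr_of_eventuallyEq
        hFF').differentiableAt one_ne_zero
    have h5 : HasFDerivAt (fun z => F z v w) _ y :=
      (hFd.hasFDerivAt.clm_apply (hasFDerivAt_const v y)).clm_apply (hasFDerivAt_const w y)
    have h6 := h5.unique (h3.congr_of_eventuallyEq (hFF'.mono fun z hz => by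
      simp only [hz, ContinuousLinearMap.bilinearComp_apply]))
    have h7 := congrArg (fun L => L u) h6
    simp at h7
    rw [h7, fderiv_form_eq hF hd hsymm, hFy]
    simp only [ContinuousLinearMap.bilinearComp_apply, T, he, map_add, add_apply]
    ring

end General

/-! ### The inner product on `(1,1)`-tensors -/

section TensorInner

variable {n : ℕ}

/-- The adjoint of an endomorphism with respect to a bilinear form. -/
def formAdjoint {W : Type*} [NormedAddCommGroup W] [NormedSpace ℝ W] (b : W →L[ℝ] W →L[ℝ] ℝ)
    (B : W →L[ℝ] W) : W →L[ℝ] W :=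
  sharp b ∘L (ContinuousLinearMap.compL ℝ W W ℝ).flip B ∘L b

theorem formAdjoint_apply {W : Type*} [NormedAddCommGroup W] [NormedSpace ℝ W]
    {b : W →L[ℝ] W →L[ℝ] ℝ} (hb : b.IsInvertible) (B : W →L[ℝ] W) (v w : W) :
    b (formAdjoint b B v) w = b v (B w) := by
  simp [formAdjoint, apply_sharp hb]

variable {b : EuclideanSpace ℝ (Fin n) →L[ℝ] EuclideanSpace ℝ (Fin n) →L[ℝ] ℝ}

/-- The basis-free form of the double sum, from which coordinate invariance and the derivative are
obtained. The sum over `l` is the expansion of a covector in the dual basis. -/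
theorem tensorInner_eq_trace (hb : b.IsInvertible)
    (A B : EuclideanSpace ℝ (Fin n) →L[ℝ] EuclideanSpace ℝ (Fin n)) :
    tensorInner b A B = LinearMap.trace ℝ (EuclideanSpace ℝ (Fin n))
      (formAdjoint b B ∘L A).toLinearMap := by
  have hsum : ∀ φ : EuclideanSpace ℝ (Fin n) →L[ℝ] ℝ,
      ∑ l, φ (EuclideanSpace.single l 1) • (EuclideanSpace.proj l : _ →L[ℝ] ℝ) = φ := fun φ => by
    ext v
    conv_rhs => rw [← (EuclideanSpace.basisFun (Fin n) ℝ).sum_repr v]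
    simp [mul_comm]
  rw [LinearMap.trace_eq_sum_inner _ (EuclideanSpace.basisFun (Fin n) ℝ), tensorInner_apply]
  refine Finset.sum_congr rfl fun j _ => ?_
  simp only [EuclideanSpace.basisFun_apply, EuclideanSpace.inner_single_left, map_one, one_mul]
  have h := congrArg (fun φ => sharp b φ j)
    (hsum (b (formAdjoint b B (A (EuclideanSpace.single j 1)))))
  simp only [sharp_apply hb, map_sum, map_smul] at h
  simp only [ContinuousLinearMap.coe_coe, ContinuousLinearMap.coe_comp, Function.comp_apply, ← h]
  simp [formAdjoint_apply hb, mul_comm]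

theorem tensorInner_symm (hb : b.IsInvertible) (hs : ∀ v w, b v w = b w v)
    (A B : EuclideanSpace ℝ (Fin n) →L[ℝ] EuclideanSpace ℝ (Fin n)) :
    tensorInner b A B = tensorInner b B A := by
  have hsh : ∀ φ ψ : EuclideanSpace ℝ (Fin n) →L[ℝ] ℝ,
      φ (sharp b ψ) = ψ (sharp b φ) := fun φ ψ => by
    conv_lhs => rw [← apply_sharp hb φ]
    rw [hs, apply_sharp hb]
  have : ∀ j l, sharp b (EuclideanSpace.proj l) j = sharp b (EuclideanSpace.proj j) l :=
    fun j l => hsh (EuclideanSpace.proj j) (EuclideanSpace.proj l)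
  rw [tensorInner_apply, tensorInner_apply, Finset.sum_comm]
  refine Finset.sum_congr rfl fun l _ => Finset.sum_congr rfl fun j _ => ?_
  rw [this j l, hs]

/-- Testing against the rank-one endomorphisms `φ ⊗ v` recovers every value `b (A (sharp b φ)) v`,
and the vectors `sharp b φ` exhaust the space. -/
theorem eq_zero_of_tensorInner_eq_zero (hb : b.IsInvertible) (hs : ∀ v w, b v w = b w v)
    {A : EuclideanSpace ℝ (Fin n) →L[ℝ] EuclideanSpace ℝ (Fin n)}
    (hA : ∀ B, tensorInner b A B = 0) : A = 0 := by
  have h1 : ∀ v φ, b (A (sharp b φ)) v = 0 := fun v φ => by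
    have h := hA (ContinuousLinearMap.smulRight φ v)
    rw [tensorInner_symm hb hs, tensorInner_eq_trace hb] at h
    have h2 : (formAdjoint b A ∘L ContinuousLinearMap.smulRight φ v).toLinearMap =
        LinearMap.smulRight φ.toLinearMap (formAdjoint b A v) := by
      ext x; simp
    rw [h2, LinearMap.trace_smulRight] at h
    rw [hs, ← formAdjoint_apply hb, hs, apply_sharp hb]
    exact h
  ext1 x
  rw [← sharp_apply hb (A x), ← sharp_apply hb x]
  have : b (A (sharp b (b x))) = 0 := by ext v; exact h1 v _
  rw [this]; simp

/-- Pulling `b` back by `e` conjugates adjoints by `e`, and the trace is invariant under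
conjugation. -/
theorem tensorInner_bilinearComp (hb : b.IsInvertible)
    (e : EuclideanSpace ℝ (Fin n) ≃L[ℝ] EuclideanSpace ℝ (Fin n))
    (A B : EuclideanSpace ℝ (Fin n) →L[ℝ] EuclideanSpace ℝ (Fin n)) :
    tensorInner (b.bilinearComp (e : EuclideanSpace ℝ (Fin n) →L[ℝ] EuclideanSpace ℝ (Fin n))
        (e : EuclideanSpace ℝ (Fin n) →L[ℝ] EuclideanSpace ℝ (Fin n))) A B =
      tensorInner b (e ∘L A ∘L (e.symm : _ →L[ℝ] _)) (e ∘L B ∘L (e.symm : _ →L[ℝ] _)) := by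
  have hb' : (b.bilinearComp (e : EuclideanSpace ℝ (Fin n) →L[ℝ] EuclideanSpace ℝ (Fin n))
        (e : EuclideanSpace ℝ (Fin n) →L[ℝ] EuclideanSpace ℝ (Fin n))).IsInvertible := by
    refine isInvertible_of_injective (injective_of_nondegenerate fun v hv => ?_)
    refine e.injective ?_
    rw [map_zero, ← sharp_apply hb (e v)]
    have : b (e v) = 0 := by
      ext w
      simpa using hv (e.symm w)
    rw [this, map_zero]
  rw [tensorInner_eq_trace hb, tensorInner_eq_trace hb',
    ← LinearMap.trace_conj' _ e.toLinearEquiv]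
  congr 1
  ext1 v
  have key : ∀ x, e (formAdjoint (b.bilinearComp
      (e : EuclideanSpace ℝ (Fin n) →L[ℝ] EuclideanSpace ℝ (Fin n))
      (e : EuclideanSpace ℝ (Fin n) →L[ℝ] EuclideanSpace ℝ (Fin n))) B x) =
      formAdjoint b (e ∘L B ∘L (e.symm : _ →L[ℝ] _)) (e x) := fun x => by
    rw [← sharp_apply hb (e _), ← sharp_apply hb (formAdjoint b _ (e x))]
    congr 1
    ext w
    rw [formAdjoint_apply hb]
    have := formAdjoint_apply hb' B x (e.symm w)
    simpa using this
  simp [LinearEquiv.conj_apply, key]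

theorem contDiffAt_tensorInner {X : Type*} [NormedAddCommGroup X] [NormedSpace ℝ X] {k : ℕ∞ω}
    {G : X → EuclideanSpace ℝ (Fin n) →L[ℝ] EuclideanSpace ℝ (Fin n) →L[ℝ] ℝ} {y : X}
    (hb : (G y).IsInvertible) (hG : ContDiffAt ℝ k G y) :
    ContDiffAt ℝ k (fun z => tensorInner (G z)) y := by
  unfold tensorInner
  refine ContDiffAt.sum fun j _ => ContDiffAt.sum fun l _ => ContDiffAt.fun_smul ?_ ?_
  · exact (EuclideanSpace.proj (𝕜 := ℝ) j).contDiff.contDiffAt.comp y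
      ((contDiffAt_sharp hG hb).clm_apply contDiffAt_const)
  · exact contDiffAt_flip ((contDiffAt_flip (hG.clm_comp contDiffAt_const)).clm_comp
      contDiffAt_const)

/-- The metric induced on `(1,1)`-tensors is parallel. -/
theorem fderiv_tensorInner {X : Type*} [NormedAddCommGroup X] [NormedSpace ℝ X]
    {G : X → EuclideanSpace ℝ (Fin n) →L[ℝ] EuclideanSpace ℝ (Fin n) →L[ℝ] ℝ} {y : X}
    (hb : ∀ᶠ z in 𝓝 y, (G z).IsInvertible) (hG : ContDiffAt ℝ 1 G y) {u : X}
    {C : EuclideanSpace ℝ (Fin n) →L[ℝ] EuclideanSpace ℝ (Fin n)}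
    (hC : ∀ v w, fderiv ℝ G y u v w = G y (C v) w + G y v (C w))
    (A B : EuclideanSpace ℝ (Fin n) →L[ℝ] EuclideanSpace ℝ (Fin n)) :
    fderiv ℝ (fun z => tensorInner (G z)) y u A B =
      tensorInner (G y) (C ∘L A - A ∘L C) B + tensorInner (G y) A (C ∘L B - B ∘L C) := by
  have hby := hb.self_of_nhds
  have hGd := hG.differentiableAt one_ne_zero
  have hadj : DifferentiableAt ℝ (fun z => formAdjoint (G z) B) y := by
    unfold formAdjoint
    exact ((contDiffAt_sharp hG hby).differentiableAt one_ne_zero).clm_comp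
      ((differentiableAt_const _).clm_comp hGd)
  -- Obtained by differentiating the defining identity `G(B* v, w) = G(v, B w)`: taking adjoints
  -- commutes with covariant differentiation.
  have hadj' : fderiv ℝ (fun z => formAdjoint (G z) B) y u =
      formAdjoint (G y) B ∘L C - C ∘L formAdjoint (G y) B +
        formAdjoint (G y) (C ∘L B - B ∘L C) := by
    ext1 v
    refine hby.injective ?_
    ext w
    have h1 : HasFDerivAt (fun z => G z (formAdjoint (G z) B v) w) _ y :=
      (hGd.hasFDerivAt.clm_apply (hadj.hasFDerivAt.clm_apply (hasFDerivAt_const v y))).clm_apply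
        (hasFDerivAt_const w y)
    have h2 : HasFDerivAt (fun z => G z v (B w)) _ y :=
      (hGd.hasFDerivAt.clm_apply (hasFDerivAt_const v y)).clm_apply (hasFDerivAt_const (B w) y)
    have h3 := h1.unique (h2.congr_of_eventuallyEq
      (hb.mono fun z hz => formAdjoint_apply hz B v w))
    have h4 := congrArg (fun L => L u) h3
    simp [hC, formAdjoint_apply hby] at h4
    simp [formAdjoint_apply hby]
    linarith
  have h1 : HasFDerivAt (fun z => tensorInner (G z) A B) _ y :=
    ((((contDiffAt_tensorInner hby hG).differentiableAt one_ne_zero).hasFDerivAt.clm_apply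
      (hasFDerivAt_const A y)).clm_apply (hasFDerivAt_const B y))
  let tr : (EuclideanSpace ℝ (Fin n) →L[ℝ] EuclideanSpace ℝ (Fin n)) →L[ℝ] ℝ :=
    (LinearMap.trace ℝ (EuclideanSpace ℝ (Fin n)) ∘ₗ
      ContinuousLinearMap.coeLM ℝ).toContinuousLinearMap
  have htr : ∀ D, tr D = LinearMap.trace ℝ (EuclideanSpace ℝ (Fin n)) D.toLinearMap :=
    fun D => rfl
  have htrc : ∀ D E, tr (D ∘L E) = tr (E ∘L D) := fun D E => LinearMap.trace_mul_comm ℝ _ _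
  have h2 : HasFDerivAt (fun z => tr (formAdjoint (G z) B ∘L A)) _ y :=
    tr.hasFDerivAt.comp y (hadj.hasFDerivAt.clm_comp (hasFDerivAt_const A y))
  have h3 := h1.unique (h2.congr_of_eventuallyEq
    (hb.mono fun z hz => tensorInner_eq_trace hz A B))
  have h4 := congrArg (fun L => L u) h3
  simp [hadj'] at h4
  rw [h4]
  simp only [map_sub, sub_apply, tensorInner_eq_trace hby, ← htr, ContinuousLinearMap.comp_assoc]
  -- Cyclicity of the trace brings the term that begins with `C` to the form in which it occurs on
  -- the right.
  rw [htrc C]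
  simp only [ContinuousLinearMap.comp_assoc]

end TensorInner

/-! ### A Riemannian metric and its conformal rescaling in coordinates -/

section Local

variable {V : Type*} [NormedAddCommGroup V] [NormedSpace ℝ V]

/-- `G` is the coordinate expression of a Riemannian metric on `U`, and `φ` is the coordinate
expression of a positive function. -/
structure IsCoordMetric (U : Set V) (G : V → V →L[ℝ] V →L[ℝ] ℝ) (φ : V → ℝ) : Prop where
  isOpen : IsOpen U
  smooth : ∀ y ∈ U, ContDiffAt ℝ ∞ G y
  symm : ∀ y ∈ U, ∀ v w, G y v w = G y w v
  pos : ∀ y ∈ U, ∀ v, v ≠ 0 → 0 < G y v v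
  smooth_fun : ∀ y ∈ U, ContDiffAt ℝ ∞ φ y
  pos_fun : ∀ y ∈ U, 0 < φ y

theorem clm_mul_apply (A B : V →L[ℝ] V) (v : V) : (A * B) v = A (B v) := rfl

/-- The curvature `R(u, v)` as an endomorphism. -/
def curvatureOp (G : V → V →L[ℝ] V →L[ℝ] ℝ) (y u v : V) : V →L[ℝ] V :=
  fderiv ℝ (christoffel G) y u v - fderiv ℝ (christoffel G) y v u
    + christoffel G y u * christoffel G y v - christoffel G y v * christoffel G y u

/-- The Christoffel symbols of the metric `φ • G`. -/
def conformalChristoffel (G : V → V →L[ℝ] V →L[ℝ] ℝ) (φ : V → ℝ) (y u v : V) : V :=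
  christoffel G y u v + (1 / (2 * φ y)) • coordA G φ y u v

theorem coordA_add_right (G : V → V →L[ℝ] V →L[ℝ] ℝ) (φ : V → ℝ) (y u v w : V) :
    coordA G φ y u (v + w) = coordA G φ y u v + coordA G φ y u w := by
  simp only [coordA, map_add, add_smul, smul_add]
  abel

theorem coordA_smul_right (G : V → V →L[ℝ] V →L[ℝ] ℝ) (φ : V → ℝ) (y u : V) (c : ℝ) (v : V) :
    coordA G φ y u (c • v) = c • coordA G φ y u v := by
  simp only [coordA, map_smul, smul_eq_mul]
  module

namespace IsCoordMetric

variable {U : Set V} {G : V → V →L[ℝ] V →L[ℝ] ℝ} {φ : V → ℝ} {y : V}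

theorem eventually_mem (h : IsCoordMetric U G φ) (hy : y ∈ U) : ∀ᶠ z in 𝓝 y, z ∈ U :=
  h.isOpen.mem_nhds hy

theorem eventually_symm (h : IsCoordMetric U G φ) (hy : y ∈ U) :
    ∀ᶠ z in 𝓝 y, ∀ v w, G z v w = G z w v :=
  (h.eventually_mem hy).mono h.symm

theorem differentiableAt (h : IsCoordMetric U G φ) (hy : y ∈ U) : DifferentiableAt ℝ G y :=
  (h.smooth y hy).differentiableAt (by simp)

theorem christoffel_symm (h : IsCoordMetric U G φ) (hy : y ∈ U) (u v : V) :
    christoffel G y u v = christoffel G y v u :=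
  RescaledSasaki.christoffel_symm (h.differentiableAt hy) (h.eventually_symm hy) u v

theorem coordA_symm (h : IsCoordMetric U G φ) (hy : y ∈ U) (u v : V) :
    coordA G φ y u v = coordA G φ y v u := by
  rw [coordA, coordA, h.symm y hy u v]
  abel

theorem conformalChristoffel_symm (h : IsCoordMetric U G φ) (hy : y ∈ U) (u v : V) :
    conformalChristoffel G φ y u v = conformalChristoffel G φ y v u := by
  rw [conformalChristoffel, conformalChristoffel, h.christoffel_symm hy, h.coordA_symm hy]

variable [FiniteDimensional ℝ V]

theorem isInvertible (h : IsCoordMetric U G φ) (hy : y ∈ U) : (G y).IsInvertible :=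
  isInvertible_of_injective (injective_of_pos (h.pos y hy))

theorem fderiv_eq (h : IsCoordMetric U G φ) (hy : y ∈ U) (u v w : V) :
    fderiv ℝ G y u v w = G y (christoffel G y u v) w + G y v (christoffel G y u w) :=
  fderiv_form_eq (h.isInvertible hy) (h.differentiableAt hy) (h.eventually_symm hy) u v w

theorem contDiffAt_christoffel (h : IsCoordMetric U G φ) (hy : y ∈ U) :
    ContDiffAt ℝ ∞ (christoffel G) y :=
  RescaledSasaki.contDiffAt_christoffel (h.isInvertible hy) (h.smooth y hy)

theorem differentiableAt_christoffel (h : IsCoordMetric U G φ) (hy : y ∈ U) :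
    DifferentiableAt ℝ (christoffel G) y :=
  (h.contDiffAt_christoffel hy).differentiableAt (by simp)

theorem hasFDerivAt_christoffel_apply (h : IsCoordMetric U G φ) (hy : y ∈ U) (u v : V) :
    HasFDerivAt (fun z => christoffel G z u v)
      (((fderiv ℝ (christoffel G) y).flip u).flip v) y := by
  simpa using ((h.differentiableAt_christoffel hy).hasFDerivAt.clm_apply
    (hasFDerivAt_const u y)).clm_apply (hasFDerivAt_const v y)

theorem curvatureOp_apply (h : IsCoordMetric U G φ) (hy : y ∈ U) (u v w : V) :
    curvatureOp G y u v w = coordCurvature G y u v w := by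
  rw [coordCurvature, (h.hasFDerivAt_christoffel_apply hy v w).fderiv,
    (h.hasFDerivAt_christoffel_apply hy u w).fderiv]
  rfl

theorem contDiffAt_coordA (h : IsCoordMetric U G φ) (hy : y ∈ U) (u v : V) :
    ContDiffAt ℝ ∞ (fun z => coordA G φ z u v) y := by
  have h1 : ContDiffAt ℝ ∞ (fderiv ℝ φ) y := (h.smooth_fun y hy).fderiv_right (by simp)
  have h2 := contDiffAt_sharp (h.smooth y hy) (h.isInvertible hy)
  have h3 : ContDiffAt ℝ ∞ (fun z => fderiv ℝ φ z u) y := h1.clm_apply contDiffAt_const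
  have h4 : ContDiffAt ℝ ∞ (fun z => fderiv ℝ φ z v) y := h1.clm_apply contDiffAt_const
  have h5 : ContDiffAt ℝ ∞ (fun z => G z u v) y :=
    ((h.smooth y hy).clm_apply contDiffAt_const).clm_apply contDiffAt_const
  exact ((h3.smul contDiffAt_const).add (h4.smul contDiffAt_const)).sub
    (h5.smul (h2.clm_apply h1))

theorem differentiableAt_conformalPart (h : IsCoordMetric U G φ) (hy : y ∈ U) (u v : V) :
    DifferentiableAt ℝ (fun z => (1 / (2 * φ z)) • coordA G φ z u v) y := by
  have h0 : DifferentiableAt ℝ (fun z => 2 * φ z) y :=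
    ((h.smooth_fun y hy).differentiableAt (by simp)).const_mul 2
  have hne : 2 * φ y ≠ 0 := (mul_pos two_pos (h.pos_fun y hy)).ne'
  have h1 : DifferentiableAt ℝ (fun z => 1 / (2 * φ z)) y := by
    simpa only [one_div] using h0.fun_inv hne
  exact h1.smul ((h.contDiffAt_coordA hy u v).differentiableAt (by simp))

theorem hasFDerivAt_conformalChristoffel (h : IsCoordMetric U G φ) (hy : y ∈ U) (u v : V) :
    HasFDerivAt (fun z => conformalChristoffel G φ z u v)
      (fderiv ℝ (fun z => christoffel G z u v) y +
        fderiv ℝ (fun z => (1 / (2 * φ z)) • coordA G φ z u v) y) y :=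
  (h.hasFDerivAt_christoffel_apply hy u v).differentiableAt.hasFDerivAt.add
    (h.differentiableAt_conformalPart hy u v).hasFDerivAt

/-- The curvature of the metric `φ • G`. -/
theorem conformalCurvature (h : IsCoordMetric U G φ) (hy : y ∈ U) (u v w : V) :
    fderiv ℝ (fun z => conformalChristoffel G φ z v w) y u
      - fderiv ℝ (fun z => conformalChristoffel G φ z u w) y v
      + conformalChristoffel G φ y u (conformalChristoffel G φ y v w)
      - conformalChristoffel G φ y v (conformalChristoffel G φ y u w) =
      coordCurvature G y u v w + coordObstruction G φ y u v w := by
  have hφ := (h.pos_fun y hy).ne'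
  rw [(h.hasFDerivAt_conformalChristoffel hy v w).fderiv,
    (h.hasFDerivAt_conformalChristoffel hy u w).fderiv]
  have hc : (1 / (4 * φ y ^ 2) : ℝ) = (1 / (2 * φ y)) * (1 / (2 * φ y)) := by
    field_simp; norm_num
  -- Expanding the curvature of `Γ + S` with `S = A / (2φ)` gives `R`, the terms `[S, S]`, and the
  -- derivatives of `S` with the cross terms in `Γ`. The last group is the antisymmetrized covariant
  -- derivative of `S`; its terms `S(Γ(u, v), w)` cancel by symmetry of `Γ`.
  simp only [coordCurvature, coordObstruction, coordCovDeriv, conformalChristoffel, hc,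
    coordA_add_right, coordA_smul_right, map_add, map_smul, add_apply,
    h.christoffel_symm hy v u]
  module

/-- The metric `φ • G` is parallel for its Christoffel symbols. -/
theorem fderiv_conformal (h : IsCoordMetric U G φ) (hy : y ∈ U) (u v w : V) :
    fderiv ℝ φ y u * G y v w + φ y * fderiv ℝ G y u v w =
      φ y * (G y (conformalChristoffel G φ y u v) w + G y v (conformalChristoffel G φ y u w)) := by
  have hφ := (h.pos_fun y hy).ne'
  have hs : ∀ ψ v, G y v (sharp (G y) ψ) = ψ v := fun ψ v => by
    rw [h.symm y hy, apply_sharp (h.isInvertible hy)]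
  rw [h.fderiv_eq hy]
  -- In `G(A(u, v), w) + G(v, A(u, w))` everything cancels except `2 dφ(u) G(v, w)`; this is the
  -- reason for the factor `1 / (2φ)`.
  simp only [conformalChristoffel, coordA, map_add, map_sub, map_smul, add_apply,
    sub_apply, smul_apply, smul_eq_mul, apply_sharp (h.isInvertible hy), hs,
    h.symm y hy u v]
  field_simp
  rw [h.symm y hy v u]
  ring

/-- Differentiating the identity that `G` is parallel a second time expresses `∂_u ∂_v G(a, b)`
through `Γ` and its derivative. Symmetry of second derivatives in `u`, `v` then leaves exactly the
skewness of `R(u, v)`. -/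
theorem curvatureOp_skew (h : IsCoordMetric U G φ) (hy : y ∈ U) (u v a b : V) :
    G y (curvatureOp G y u v a) b + G y a (curvatureOp G y u v b) = 0 := by
  have hG := h.smooth y hy
  have hd : HasFDerivAt (fderiv ℝ G) (fderiv ℝ (fderiv ℝ G) y) y :=
    ((hG.fderiv_right (m := ∞) (by simp)).differentiableAt (by simp)).hasFDerivAt
  have key : ∀ u v, fderiv ℝ (fderiv ℝ G) y u v a b =
      G y (christoffel G y u (christoffel G y v a)) b
      + G y (christoffel G y v a) (christoffel G y u b)
      + G y (fderiv ℝ (christoffel G) y u v a) b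
      + G y (christoffel G y u a) (christoffel G y v b)
      + G y a (christoffel G y u (christoffel G y v b))
      + G y a (fderiv ℝ (christoffel G) y u v b) := fun u v => by
    have h1 : HasFDerivAt (fun z => fderiv ℝ G z v a b) _ y :=
      ((hd.clm_apply (hasFDerivAt_const v y)).clm_apply (hasFDerivAt_const a y)).clm_apply
        (hasFDerivAt_const b y)
    have hGd := (h.differentiableAt hy).hasFDerivAt
    have h2 : HasFDerivAt (fun z => G z (christoffel G z v a) b + G z a (christoffel G z v b))
        _ y :=
      ((hGd.clm_apply (h.hasFDerivAt_christoffel_apply hy v a)).clm_apply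
        (hasFDerivAt_const b y)).add
      ((hGd.clm_apply (hasFDerivAt_const a y)).clm_apply
        (h.hasFDerivAt_christoffel_apply hy v b))
    have h3 := congrArg (fun L => L u) (h1.unique (h2.congr_of_eventuallyEq
      ((h.eventually_mem hy).mono fun z hz => h.fderiv_eq hz v a b)))
    simp [h.fderiv_eq hy] at h3
    rw [h3]
    ring
  have hsy := ((hG.of_le (m := 2) ENat.LEInfty.out).isSymmSndFDerivAt (by simp)).eq u v
  have h4 := congrArg (fun L => L a b) hsy
  simp only [key] at h4
  simp only [curvatureOp, add_apply, sub_apply, map_add, map_sub, clm_mul_apply]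
  linarith

/-- Commuting with the rank-one map `x ↦ G(w, x) w` gives `G(w, w) R w = G(w, R w) w`, whose right
side is zero by skewness. -/
theorem curvatureOp_eq_zero_of_commute (h : IsCoordMetric U G φ) (hy : y ∈ U) {u v : V}
    (hc : ∀ C : V →L[ℝ] V, Commute (curvatureOp G y u v) C) : curvatureOp G y u v = 0 := by
  ext w
  by_cases hw : w = 0
  · simp [hw]
  have h1 := congrArg (fun L => L w) (hc (ContinuousLinearMap.smulRight (G y w) w)).eq
  have h2 := h.curvatureOp_skew hy u v w w
  rw [h.symm y hy _ w, ← two_mul] at h2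
  have h3 : G y w (curvatureOp G y u v w) = 0 := by linarith
  simp only [clm_mul_apply, ContinuousLinearMap.smulRight_apply, h3, map_smul,
    zero_smul] at h1
  exact (smul_eq_zero.1 h1).resolve_left (h.pos y hy w hw).ne'

end IsCoordMetric

end Local

/-! ### The direct-sum connection on the tensor bundle and its curvature -/

section VerticalField

variable {V : Type*} [NormedAddCommGroup V] [NormedSpace ℝ V]

/-- The projection to the vertical part, in the coordinates induced by coordinates of the base. -/
def verticalField (G : V → V →L[ℝ] V →L[ℝ] ℝ) (z : V × (V →L[ℝ] V)) :
    V × (V →L[ℝ] V) →L[ℝ] (V →L[ℝ] V) :=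
  verticalPart (christoffel G z.1) z.2

theorem verticalField_apply (G : V → V →L[ℝ] V →L[ℝ] ℝ) (z ξ : V × (V →L[ℝ] V)) :
    verticalField G z ξ = ξ.2 + (christoffel G z.1 ξ.1 * z.2 - z.2 * christoffel G z.1 ξ.1) := rfl

/-- Identities between tangent vectors of the bundle are checked below on the base component and on
`K`, where the connection has a simple form. -/
theorem ext_verticalField {G : V → V →L[ℝ] V →L[ℝ] ℝ} {z ξ η : V × (V →L[ℝ] V)}
    (h1 : ξ.1 = η.1) (h2 : verticalField G z ξ = verticalField G z η) : ξ = η := by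
  rw [verticalField_apply, verticalField_apply, h1] at h2
  exact Prod.ext h1 (add_right_cancel h2)

/-- The vector with given horizontal and vertical parts. -/
def ofParts (G : V → V →L[ℝ] V →L[ℝ] ℝ) (z : V × (V →L[ℝ] V)) (X : V) (A : V →L[ℝ] V) :
    V × (V →L[ℝ] V) :=
  (X, A - (christoffel G z.1 X * z.2 - z.2 * christoffel G z.1 X))

theorem verticalField_ofParts (G : V → V →L[ℝ] V →L[ℝ] ℝ) (z : V × (V →L[ℝ] V)) (X : V)
    (A : V →L[ℝ] V) : verticalField G z (ofParts G z X A) = A := by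
  simp [verticalField_apply, ofParts]

/-- The Christoffel symbols of the Sasaki type metric, at points where the curvature operators
commute with the tensor. -/
def sasakiChristoffel (G : V → V →L[ℝ] V →L[ℝ] ℝ) (φ : V → ℝ) (z ξ η : V × (V →L[ℝ] V)) :
    V × (V →L[ℝ] V) :=
  ofParts G z (conformalChristoffel G φ z.1 ξ.1 η.1)
    (fderiv ℝ (verticalField G) z ξ η
      + (christoffel G z.1 ξ.1 * verticalField G z η - verticalField G z η * christoffel G z.1 ξ.1))

theorem verticalField_sasakiChristoffel (G : V → V →L[ℝ] V →L[ℝ] ℝ) (φ : V → ℝ)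
    (z ξ η : V × (V →L[ℝ] V)) :
    verticalField G z (sasakiChristoffel G φ z ξ η) = fderiv ℝ (verticalField G) z ξ η
      + (christoffel G z.1 ξ.1 * verticalField G z η
        - verticalField G z η * christoffel G z.1 ξ.1) :=
  verticalField_ofParts ..

namespace IsCoordMetric

variable [FiniteDimensional ℝ V] {U : Set V} {G : V → V →L[ℝ] V →L[ℝ] ℝ} {φ : V → ℝ}
  {z : V × (V →L[ℝ] V)}

theorem contDiffAt_verticalField (h : IsCoordMetric U G φ) (hz : z.1 ∈ U) :
    ContDiffAt ℝ ∞ (verticalField G) z := by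
  have h1 : ContDiffAt ℝ ∞ (fun w : V × (V →L[ℝ] V) => christoffel G w.1) z :=
    (h.contDiffAt_christoffel hz).comp z contDiffAt_fst
  have h2 : ContDiffAt ℝ ∞ (fun w : V × (V →L[ℝ] V) =>
      (ContinuousLinearMap.compL ℝ V V V).flip w.2 - ContinuousLinearMap.compL ℝ V V V w.2) z :=
    ((ContinuousLinearMap.compL ℝ V V V).flip -
      ContinuousLinearMap.compL ℝ V V V).contDiff.contDiffAt.comp z contDiffAt_snd
  exact contDiffAt_const.add (h2.clm_comp (h1.clm_comp contDiffAt_const))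

theorem hasFDerivAt_verticalField (h : IsCoordMetric U G φ) (hz : z.1 ∈ U) :
    HasFDerivAt (verticalField G) (fderiv ℝ (verticalField G) z) z :=
  ((h.contDiffAt_verticalField hz).differentiableAt (by simp)).hasFDerivAt

theorem fderiv_verticalField (h : IsCoordMetric U G φ) (hz : z.1 ∈ U) (ξ η : V × (V →L[ℝ] V)) :
    fderiv ℝ (verticalField G) z ξ η =
      (fderiv ℝ (christoffel G) z.1 ξ.1 η.1 * z.2 - z.2 * fderiv ℝ (christoffel G) z.1 ξ.1 η.1)
      + (christoffel G z.1 η.1 * ξ.2 - ξ.2 * christoffel G z.1 η.1) := by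
  have h1 : HasFDerivAt (fun w => verticalField G w η) _ z :=
    (h.hasFDerivAt_verticalField hz).clm_apply (hasFDerivAt_const η z)
  have h2 : HasFDerivAt (fun w : V × (V →L[ℝ] V) => christoffel G w.1 η.1) _ z :=
    ((h.differentiableAt_christoffel hz).hasFDerivAt.comp z hasFDerivAt_fst).clm_apply
      (hasFDerivAt_const η.1 z)
  have h3 : HasFDerivAt (fun w : V × (V →L[ℝ] V) =>
      η.2 + (christoffel G w.1 η.1 ∘L w.2 - w.2 ∘L christoffel G w.1 η.1)) _ z :=
    ((h2.clm_comp hasFDerivAt_snd).sub (hasFDerivAt_snd.clm_comp h2)).const_add η.2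
  have h4 := congrArg (fun L => L ξ) (h1.unique h3)
  simp at h4
  rw [h4]
  simp only [ContinuousLinearMap.mul_def]
  abel

/-- The horizontal part is always symmetric. By the Jacobi identity the antisymmetrized vertical
part is `[R(ξ₁, η₁), t]`, which is zero by `hc`. -/
theorem sasakiChristoffel_symm (h : IsCoordMetric U G φ) (hz : z.1 ∈ U)
    (hc : ∀ u v, Commute (curvatureOp G z.1 u v) z.2) (ξ η : V × (V →L[ℝ] V)) :
    sasakiChristoffel G φ z ξ η = sasakiChristoffel G φ z η ξ := by
  refine ext_verticalField (G := G) (z := z) (h.conformalChristoffel_symm hz _ _) ?_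
  rw [verticalField_sasakiChristoffel, verticalField_sasakiChristoffel,
    h.fderiv_verticalField hz, h.fderiv_verticalField hz, verticalField_apply, verticalField_apply]
  have := (hc ξ.1 η.1).eq
  rw [curvatureOp, ← sub_eq_zero] at this
  rw [← sub_eq_zero, ← this]
  noncomm_ring

theorem differentiableAt_sasakiChristoffel (h : IsCoordMetric U G φ) (hz : z.1 ∈ U)
    (ξ η : V × (V →L[ℝ] V)) : DifferentiableAt ℝ (fun w => sasakiChristoffel G φ w ξ η) z := by
  have h0 : DifferentiableAt ℝ (fun w : V × (V →L[ℝ] V) =>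
      conformalChristoffel G φ w.1 ξ.1 η.1) z :=
    (h.hasFDerivAt_conformalChristoffel hz ξ.1 η.1).differentiableAt.comp z differentiableAt_fst
  have h1 : DifferentiableAt ℝ (fun w : V × (V →L[ℝ] V) => christoffel G w.1) z :=
    (h.differentiableAt_christoffel hz).comp z differentiableAt_fst
  have h2 : DifferentiableAt ℝ (fun w => fderiv ℝ (verticalField G) w ξ η) z :=
    ((((h.contDiffAt_verticalField hz).fderiv_right (m := ∞) (by simp)).differentiableAt
      (by simp)).clm_apply (differentiableAt_const _)).clm_apply (differentiableAt_const _)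
  have h3 : DifferentiableAt ℝ (fun w => verticalField G w η) z :=
    (h.hasFDerivAt_verticalField hz).differentiableAt.clm_apply (differentiableAt_const _)
  have h4 : DifferentiableAt ℝ (fun w : V × (V →L[ℝ] V) => christoffel G w.1 ξ.1) z :=
    h1.clm_apply (differentiableAt_const _)
  have h5 : DifferentiableAt ℝ (fun w : V × (V →L[ℝ] V) =>
      christoffel G w.1 (conformalChristoffel G φ w.1 ξ.1 η.1)) z := h1.clm_apply h0
  unfold sasakiChristoffel ofParts
  exact h0.prodMk ((h2.add ((h4.mul h3).sub (h3.mul h4))).sub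
    ((h5.mul differentiableAt_snd).sub (differentiableAt_snd.mul h5)))

/-- The curvature of the connection with the symbols `sasakiChristoffel`. -/
theorem curvature_sasakiChristoffel (h : IsCoordMetric U G φ) (hz : z.1 ∈ U)
    (ξ η ζ : V × (V →L[ℝ] V)) :
    let T := sasakiChristoffel G φ
    let R := fderiv ℝ (fun w => T w η ζ) z ξ - fderiv ℝ (fun w => T w ξ ζ) z η
      + T z ξ (T z η ζ) - T z η (T z ξ ζ)
    R.1 = coordCurvature G z.1 ξ.1 η.1 ζ.1 + coordObstruction G φ z.1 ξ.1 η.1 ζ.1 ∧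
      verticalField G z R = curvatureOp G z.1 ξ.1 η.1 * verticalField G z ζ
        - verticalField G z ζ * curvatureOp G z.1 ξ.1 η.1 := by
  intro T R
  constructor
  · have hT : ∀ ξ η ζ : V × (V →L[ℝ] V), (fderiv ℝ (fun w => T w η ζ) z ξ).1 =
        fderiv ℝ (fun y => conformalChristoffel G φ y η.1 ζ.1) z.1 ξ.1 := fun ξ η ζ => by
      have h1 := (hasFDerivAt_fst (𝕜 := ℝ) (p := T z η ζ)).comp z
        (h.differentiableAt_sasakiChristoffel hz η ζ).hasFDerivAt
      have h2 := (h.hasFDerivAt_conformalChristoffel hz η.1 ζ.1).differentiableAt.hasFDerivAt.comp z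
        (hasFDerivAt_fst (𝕜 := ℝ) (p := z))
      exact congrArg (fun L => L ξ) (h1.unique h2)
    rw [← h.conformalCurvature hz]
    simp only [R, Prod.fst_add, Prod.fst_sub, hT]
    rfl
  · have hd2 : HasFDerivAt (fderiv ℝ (verticalField G)) _ z :=
      (((h.contDiffAt_verticalField hz).fderiv_right (m := ∞) (by simp)).differentiableAt
        (by simp)).hasFDerivAt
    have hd := h.hasFDerivAt_verticalField hz
    -- Only `K(T(η, ζ))` has a simple formula. Differentiating it by the product rule yields `K` of
    -- the derivative of `T`, at the cost of the term `(D_ξ K)(T(η, ζ))`.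
    have hT : ∀ ξ η ζ : V × (V →L[ℝ] V), verticalField G z (fderiv ℝ (fun w => T w η ζ) z ξ) =
        fderiv ℝ (fderiv ℝ (verticalField G)) z ξ η ζ
          + (fderiv ℝ (christoffel G) z.1 ξ.1 η.1 * verticalField G z ζ
            - verticalField G z ζ * fderiv ℝ (christoffel G) z.1 ξ.1 η.1)
          + (christoffel G z.1 η.1 * fderiv ℝ (verticalField G) z ξ ζ
            - fderiv ℝ (verticalField G) z ξ ζ * christoffel G z.1 η.1)
          - fderiv ℝ (verticalField G) z ξ (T z η ζ) := fun ξ η ζ => by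
      have h1 : HasFDerivAt (fun w => verticalField G w (T w η ζ)) _ z :=
        hd.clm_apply (h.differentiableAt_sasakiChristoffel hz η ζ).hasFDerivAt
      have h2 : HasFDerivAt (fun w : V × (V →L[ℝ] V) => christoffel G w.1 η.1) _ z :=
        ((h.differentiableAt_christoffel hz).hasFDerivAt.comp z hasFDerivAt_fst).clm_apply
          (hasFDerivAt_const η.1 z)
      have h3 : HasFDerivAt (fun w => verticalField G w ζ) _ z :=
        hd.clm_apply (hasFDerivAt_const ζ z)
      have h4 : HasFDerivAt (fun w => fderiv ℝ (verticalField G) w η ζ) _ z :=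
        (hd2.clm_apply (hasFDerivAt_const η z)).clm_apply (hasFDerivAt_const ζ z)
      have h5 : HasFDerivAt (fun w => fderiv ℝ (verticalField G) w η ζ
        + (christoffel G w.1 η.1 ∘L verticalField G w ζ
          - verticalField G w ζ ∘L christoffel G w.1 η.1)) _ z :=
        h4.add ((h2.clm_comp h3).sub (h3.clm_comp h2))
      have h6 := congrArg (fun L => L ξ) (h1.unique (h5.congr_of_eventuallyEq
        (Filter.Eventually.of_forall fun w => verticalField_sasakiChristoffel G φ w η ζ)))
      simp at h6
      rw [eq_sub_iff_add_eq]
      refine h6.trans ?_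
      simp only [ContinuousLinearMap.mul_def]
      abel
    -- The second derivatives of `K` cancel in the antisymmetrization in `ξ`, `η`.
    have hs := ((((h.contDiffAt_verticalField hz).of_le (m := 2)
      ENat.LEInfty.out).isSymmSndFDerivAt (by simp)).eq ξ η)
    simp only [R, map_add, map_sub, hT, hs]
    rw [verticalField_sasakiChristoffel, verticalField_sasakiChristoffel,
      verticalField_sasakiChristoffel, verticalField_sasakiChristoffel, curvatureOp]
    noncomm_ring

end IsCoordMetric

end VerticalField

/-! ### Flatness of the Sasaki type metric in induced coordinates -/

section SasakiInCoordinates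

variable {n : ℕ}

/-- The rescaled Sasaki type metric in the coordinates induced by coordinates of the base. -/
def coordSasaki
    (G : EuclideanSpace ℝ (Fin n) → EuclideanSpace ℝ (Fin n) →L[ℝ] EuclideanSpace ℝ (Fin n) →L[ℝ] ℝ)
    (φ : EuclideanSpace ℝ (Fin n) → ℝ)
    (z : EuclideanSpace ℝ (Fin n) × (EuclideanSpace ℝ (Fin n) →L[ℝ] EuclideanSpace ℝ (Fin n))) :
    EuclideanSpace ℝ (Fin n) × (EuclideanSpace ℝ (Fin n) →L[ℝ] EuclideanSpace ℝ (Fin n)) →L[ℝ]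
      EuclideanSpace ℝ (Fin n) × (EuclideanSpace ℝ (Fin n) →L[ℝ] EuclideanSpace ℝ (Fin n)) →L[ℝ]
        ℝ :=
  sasakiForm (G z.1) (φ z.1) (christoffel G z.1) z.2

namespace IsCoordMetric

variable {U : Set (EuclideanSpace ℝ (Fin n))}
  {G : EuclideanSpace ℝ (Fin n) → EuclideanSpace ℝ (Fin n) →L[ℝ] EuclideanSpace ℝ (Fin n) →L[ℝ] ℝ}
  {φ : EuclideanSpace ℝ (Fin n) → ℝ}
  {z : EuclideanSpace ℝ (Fin n) × (EuclideanSpace ℝ (Fin n) →L[ℝ] EuclideanSpace ℝ (Fin n))}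

theorem coordSasaki_symm (h : IsCoordMetric U G φ) (hz : z.1 ∈ U) (ξ η) :
    coordSasaki G φ z ξ η = coordSasaki G φ z η ξ := by
  rw [coordSasaki, sasakiForm_apply, sasakiForm_apply, h.symm _ hz,
    tensorInner_symm (h.isInvertible hz) (h.symm _ hz)]

/-- Nondegeneracy suffices: pairing with vertical lifts removes the vertical part, and pairing with
the horizontal lift of `ξ.1` removes the rest. -/
theorem isInvertible_coordSasaki (h : IsCoordMetric U G φ) (hz : z.1 ∈ U) :
    (coordSasaki G φ z).IsInvertible := by
  refine isInvertible_of_injective (injective_of_nondegenerate fun ξ hξ => ?_)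
  have hv : verticalField G z ξ = 0 := by
    refine eq_zero_of_tensorInner_eq_zero (h.isInvertible hz) (h.symm _ hz) fun B => ?_
    have := hξ (verticalLift B)
    rw [coordSasaki, sasakiForm_apply, verticalPart_verticalLift] at this
    simpa [verticalLift, verticalField] using this
  refine ext_verticalField (G := G) (z := z) ?_ (by rw [hv, map_zero])
  by_contra hne
  have := hξ (horizontalLift (christoffel G z.1) z.2 ξ.1)
  rw [coordSasaki, sasakiForm_apply, verticalPart_horizontalLift] at this
  have h1 := mul_pos (h.pos_fun _ hz) (h.pos _ hz ξ.1 hne)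
  simp [horizontalLift] at this
  rcases this with h2 | h2 <;> simp [h2] at h1

theorem contDiffAt_coordSasaki (h : IsCoordMetric U G φ) (hz : z.1 ∈ U) :
    ContDiffAt ℝ ∞ (coordSasaki G φ) z := by
  have h1 : ContDiffAt ℝ ∞ (fun w : EuclideanSpace ℝ (Fin n) ×
      (EuclideanSpace ℝ (Fin n) →L[ℝ] EuclideanSpace ℝ (Fin n)) => G w.1) z :=
    (h.smooth _ hz).comp z contDiffAt_fst
  have h2 : ContDiffAt ℝ ∞ (fun w : EuclideanSpace ℝ (Fin n) ×
      (EuclideanSpace ℝ (Fin n) →L[ℝ] EuclideanSpace ℝ (Fin n)) => φ w.1) z :=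
    (h.smooth_fun _ hz).comp z contDiffAt_fst
  have h3 : ContDiffAt ℝ ∞ (fun w : EuclideanSpace ℝ (Fin n) ×
      (EuclideanSpace ℝ (Fin n) →L[ℝ] EuclideanSpace ℝ (Fin n)) => tensorInner (G w.1)) z :=
    contDiffAt_tensorInner (h.isInvertible hz) h1
  exact (h2.smul (contDiffAt_bilinearComp h1 contDiffAt_const)).add
    (contDiffAt_bilinearComp h3 (h.contDiffAt_verticalField hz))

/-- The Sasaki type metric is parallel for the symbols `sasakiChristoffel`. -/
theorem fderiv_coordSasaki (h : IsCoordMetric U G φ) (hz : z.1 ∈ U) (ξ η ζ) :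
    fderiv ℝ (coordSasaki G φ) z ξ η ζ =
      coordSasaki G φ z (sasakiChristoffel G φ z ξ η) ζ +
        coordSasaki G φ z η (sasakiChristoffel G φ z ξ ζ) := by
  have hfst : HasFDerivAt (fun w : EuclideanSpace ℝ (Fin n) ×
      (EuclideanSpace ℝ (Fin n) →L[ℝ] EuclideanSpace ℝ (Fin n)) => w.1)
      (ContinuousLinearMap.fst ℝ _ _) z :=
    hasFDerivAt_fst
  have hG : HasFDerivAt (fun w : EuclideanSpace ℝ (Fin n) ×
      (EuclideanSpace ℝ (Fin n) →L[ℝ] EuclideanSpace ℝ (Fin n)) => G w.1 η.1 ζ.1) _ z :=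
    (((h.differentiableAt hz).hasFDerivAt.comp z hfst).clm_apply
      (hasFDerivAt_const η.1 z)).clm_apply (hasFDerivAt_const ζ.1 z)
  have hφ : HasFDerivAt (fun w : EuclideanSpace ℝ (Fin n) ×
      (EuclideanSpace ℝ (Fin n) →L[ℝ] EuclideanSpace ℝ (Fin n)) => φ w.1) _ z :=
    ((h.smooth_fun _ hz).differentiableAt (by simp)).hasFDerivAt.comp z hfst
  have hI : HasFDerivAt (fun w : EuclideanSpace ℝ (Fin n) ×
      (EuclideanSpace ℝ (Fin n) →L[ℝ] EuclideanSpace ℝ (Fin n)) => tensorInner (G w.1)) _ z :=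
    ((contDiffAt_tensorInner (h.isInvertible hz) (h.smooth _ hz)).differentiableAt
      (by simp)).hasFDerivAt.comp z hfst
  have hK := fun η => (h.hasFDerivAt_verticalField hz).clm_apply (hasFDerivAt_const η z)
  have h1 : HasFDerivAt (fun w => coordSasaki G φ w η ζ) _ z :=
    ((((h.contDiffAt_coordSasaki hz).differentiableAt (by simp)).hasFDerivAt.clm_apply
      (hasFDerivAt_const η z)).clm_apply (hasFDerivAt_const ζ z))
  have h2 : HasFDerivAt (fun w => coordSasaki G φ w η ζ) _ z :=
    (hφ.mul hG).add ((hI.clm_apply (hK η)).clm_apply (hK ζ))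
  have h3 := congrArg (fun L => L ξ) (h1.unique h2)
  have hI' := fderiv_tensorInner ((h.eventually_mem hz).mono fun y hy => h.isInvertible hy)
    ((h.smooth _ hz).of_le ENat.LEInfty.out) (h.fderiv_eq hz ξ.1)
    (verticalField G z η) (verticalField G z ζ)
  have hc := h.fderiv_conformal hz ξ.1 η.1 ζ.1
  have hS : ∀ ξ η, coordSasaki G φ z ξ η = φ z.1 * G z.1 ξ.1 η.1
    + tensorInner (G z.1) (verticalField G z ξ) (verticalField G z η) := fun _ _ => rfl
  have hT : ∀ ξ η, (sasakiChristoffel G φ z ξ η).1 = conformalChristoffel G φ z.1 ξ.1 η.1 :=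
    fun _ _ => rfl
  have hK' : verticalPart (christoffel G z.1) z.2 = verticalField G z := rfl
  simp at h3
  rw [h3]
  simp only [hS, hK', hT, verticalField_sasakiChristoffel, hI', map_add, add_apply,
    ContinuousLinearMap.mul_def]
  -- The vertical terms match because the tensor inner product is parallel (`hI'`); the horizontal
  -- ones are compatibility of `φ • G` with its own symbols.
  linear_combination hc

theorem christoffel_coordSasaki (h : IsCoordMetric U G φ) (hz : z.1 ∈ U)
    (hc : ∀ u v, Commute (curvatureOp G z.1 u v) z.2) (ξ η) :
    christoffel (coordSasaki G φ) z ξ η = sasakiChristoffel G φ z ξ η :=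
  christoffel_eq (h.isInvertible_coordSasaki hz) (h.coordSasaki_symm hz)
    (h.sasakiChristoffel_symm hz hc) (h.fderiv_coordSasaki hz) ξ η

theorem differentiableAt_christoffel_coordSasaki (h : IsCoordMetric U G φ) (hz : z.1 ∈ U) (ξ η) :
    DifferentiableAt ℝ (fun w => christoffel (coordSasaki G φ) w ξ η) z :=
  (((RescaledSasaki.contDiffAt_christoffel (h.isInvertible_coordSasaki hz)
    (h.contDiffAt_coordSasaki hz)).differentiableAt (by simp)).clm_apply
    (differentiableAt_const _)).clm_apply (differentiableAt_const _)

/-- The curvature of the Sasaki type metric along the zero section, in horizontal directions. -/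
theorem coordCurvature_coordSasaki_zero (h : IsCoordMetric U G φ)
    {y : EuclideanSpace ℝ (Fin n)} (hy : y ∈ U) (u v) (ζ) :
    coordCurvature (coordSasaki G φ) (y, 0) (u, 0) (v, 0) ζ =
      (coordCurvature G y u v ζ.1 + coordObstruction G φ y u v ζ.1,
        curvatureOp G y u v * ζ.2 - ζ.2 * curvatureOp G y u v) := by
  have hz : ((y, 0) : EuclideanSpace ℝ (Fin n) ×
    (EuclideanSpace ℝ (Fin n) →L[ℝ] EuclideanSpace ℝ (Fin n))).1 ∈ U := hy
  have hc : ∀ x ∈ U, ∀ ξ η, christoffel (coordSasaki G φ) (x, 0) ξ η =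
      sasakiChristoffel G φ (x, 0) ξ η := fun x hx ξ η =>
    h.christoffel_coordSasaki hx (fun _ _ => Commute.zero_right _) ξ η
  -- The two families of symbols are only known to agree on the zero section, but `(u, 0)` is
  -- tangent to it; composing with `x ↦ (x, 0)` compares the derivatives.
  have hd : ∀ u η, fderiv ℝ (fun w => christoffel (coordSasaki G φ) w η ζ) (y, 0) (u, 0) =
      fderiv ℝ (fun w => sasakiChristoffel G φ w η ζ) (y, 0) (u, 0) := fun u η => by
    have hi : HasFDerivAt (fun x : EuclideanSpace ℝ (Fin n) =>
        (x, (0 : EuclideanSpace ℝ (Fin n) →L[ℝ] EuclideanSpace ℝ (Fin n)))) _ y :=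
      (hasFDerivAt_id (𝕜 := ℝ) y).prodMk (hasFDerivAt_const _ y)
    have h1 := HasFDerivAt.comp y
      (h.differentiableAt_christoffel_coordSasaki hz η ζ).hasFDerivAt hi
    have h2 := HasFDerivAt.comp y (h.differentiableAt_sasakiChristoffel hz η ζ).hasFDerivAt hi
    have h3 := congrArg (fun L => L u) (h1.unique (h2.congr_of_eventuallyEq
      ((h.eventually_mem hy).mono fun x hx => hc x hx η ζ)))
    simpa using h3
  obtain ⟨h1, h2⟩ := h.curvature_sasakiChristoffel hz (u, 0) (v, 0) ζ
  rw [coordCurvature, hc y hy, hc y hy, hc y hy, hc y hy, hd, hd]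
  have hv : ∀ ξ, verticalField G (y, 0) ξ = ξ.2 := fun ξ => by simp [verticalField_apply]
  rw [hv, hv] at h2
  exact Prod.ext h1 h2

theorem coordCurvature_coordSasaki_eq_zero (h : IsCoordMetric U G φ) (hz : z.1 ∈ U)
    (hR : ∀ y ∈ U, ∀ u v w, coordCurvature G y u v w = 0)
    (hO : ∀ y ∈ U, ∀ u v w, coordObstruction G φ y u v w = 0) (ξ η ζ) :
    coordCurvature (coordSasaki G φ) z ξ η ζ = 0 := by
  have hR' : ∀ y ∈ U, ∀ u v, curvatureOp G y u v = 0 := fun y hy u v => by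
    ext1 w
    rw [h.curvatureOp_apply hy, hR y hy]; rfl
  have hc : ∀ w : EuclideanSpace ℝ (Fin n) ×
      (EuclideanSpace ℝ (Fin n) →L[ℝ] EuclideanSpace ℝ (Fin n)), w.1 ∈ U → ∀ ξ η,
      christoffel (coordSasaki G φ) w ξ η = sasakiChristoffel G φ w ξ η := fun w hw ξ η =>
    h.christoffel_coordSasaki hw (fun u v => by
      rw [hR' _ hw]; exact Commute.zero_left _) ξ η
  have hev : ∀ ξ η, (fun w => christoffel (coordSasaki G φ) w ξ η) =ᶠ[𝓝 z]
      fun w => sasakiChristoffel G φ w ξ η := fun ξ η =>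
    (continuousAt_fst.eventually (h.eventually_mem hz)).mono fun w hw => hc w hw ξ η
  obtain ⟨h1, h2⟩ := h.curvature_sasakiChristoffel hz ξ η ζ
  rw [coordCurvature, hc z hz, hc z hz, hc z hz, hc z hz, (hev η ζ).fderiv_eq, (hev ξ ζ).fderiv_eq]
  refine ext_verticalField (G := G) (z := z) ?_ ?_
  · rw [h1, hR _ hz, hO _ hz, add_zero]; rfl
  · rw [h2, hR' _ hz, map_zero, zero_mul, mul_zero, sub_zero]

/-- For the forward direction the zero section suffices: `ζ = (0, C)` shows that `R(u, v)` commutes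
with every `C`, hence vanishes, and then `ζ = (w, 0)` isolates the obstruction. -/
theorem coordSasaki_flat_iff (h : IsCoordMetric U G φ) :
    (∀ z : EuclideanSpace ℝ (Fin n) × (EuclideanSpace ℝ (Fin n) →L[ℝ] EuclideanSpace ℝ (Fin n)),
      z.1 ∈ U → ∀ ξ η ζ, coordCurvature (coordSasaki G φ) z ξ η ζ = 0) ↔
      (∀ y ∈ U, ∀ u v w, coordCurvature G y u v w = 0) ∧
        ∀ y ∈ U, ∀ u v w, coordObstruction G φ y u v w = 0 := by
  refine ⟨fun hF => ?_, fun ⟨hR, hO⟩ z hz ξ η ζ =>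
    h.coordCurvature_coordSasaki_eq_zero hz hR hO ξ η ζ⟩
  have key : ∀ y ∈ U, ∀ (u v : EuclideanSpace ℝ (Fin n))
      (ζ : EuclideanSpace ℝ (Fin n) ×
      (EuclideanSpace ℝ (Fin n) →L[ℝ] EuclideanSpace ℝ (Fin n))),
      (coordCurvature G y u v ζ.1 + coordObstruction G φ y u v ζ.1,
      curvatureOp G y u v * ζ.2 - ζ.2 * curvatureOp G y u v) =
      (0 : EuclideanSpace ℝ (Fin n) × (EuclideanSpace ℝ (Fin n) →L[ℝ] EuclideanSpace ℝ (Fin n))) :=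
    fun y hy u v ζ => by
      rw [← h.coordCurvature_coordSasaki_zero hy, hF _ hy]
  have hR : ∀ y ∈ U, ∀ u v w, coordCurvature G y u v w = 0 := fun y hy u v w => by
    rw [← h.curvatureOp_apply hy, h.curvatureOp_eq_zero_of_commute hy fun C =>
      sub_eq_zero.1 (congrArg Prod.snd (key y hy u v (0, C)))]
    rfl
  refine ⟨hR, fun y hy u v w => ?_⟩
  have := congrArg Prod.fst (key y hy u v (w, 0))
  simpa [hR y hy] using this

end IsCoordMetric

end SasakiInCoordinates

/-! ### Coordinate expressions of metrics and changes of chart -/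

section Charts

variable {V H N : Type*} [NormedAddCommGroup V] [NormedSpace ℝ V] [TopologicalSpace H]
  {I : ModelWithCorners ℝ V H} [TopologicalSpace N] [ChartedSpace H N]

theorem contDiffAt_transition {k : ℕ∞ω} [I.Boundaryless] [IsManifold I k N] (p q : N) {y : V}
    (hy : y ∈ (extChartAt I p).target) (hq : (extChartAt I p).symm y ∈ (extChartAt I q).source) :
    ContDiffAt ℝ k (extChartAt I q ∘ (extChartAt I p).symm) y := by
  have h := contDiffWithinAt_ext_coord_change (n := k) (I := I) q p (y := y)
    (by simp only [PartialEquiv.trans_source, PartialEquiv.symm_source]; exact ⟨hy, hq⟩)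
  rwa [I.range_eq_univ, contDiffWithinAt_univ] at h

/-- The tangent space at a point is identified with `V` by the chart around that point, so the
differential of an inverse chart is the derivative of a transition map into that chart. -/
theorem metricInChart_eq [I.Boundaryless] [IsManifold I 1 N]
    (h : ∀ q : N, TangentSpace I q →L[ℝ] TangentSpace I q →L[ℝ] ℝ) (p : N) {y : V}
    (hy : y ∈ (extChartAt I p).target) :
    metricInChart I h p y =
      (show V →L[ℝ] V →L[ℝ] ℝ from h ((extChartAt I p).symm y)).bilinearComp
        (fderiv ℝ (extChartAt I ((extChartAt I p).symm y) ∘ (extChartAt I p).symm) y)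
        (fderiv ℝ (extChartAt I ((extChartAt I p).symm y) ∘ (extChartAt I p).symm) y) := by
  have h1 : HasMFDerivAt 𝓘(ℝ, V) I (extChartAt I p).symm y
      (fderiv ℝ (extChartAt I ((extChartAt I p).symm y) ∘ (extChartAt I p).symm) y) := by
    refine ⟨continuousAt_extChartAt_symm'' hy, ?_⟩
    have h2 := ((contDiffAt_transition (k := 1) p ((extChartAt I p).symm y) hy
      (mem_extChartAt_source _)).differentiableAt one_ne_zero).hasFDerivAt.hasFDerivWithinAt
      (s := Set.univ)
    change HasFDerivWithinAt (extChartAt I ((extChartAt I p).symm y) ∘ (extChartAt I p).symm) _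
      (Set.range id) y
    rwa [Set.range_id]
  have h3 : ((mfderiv 𝓘(ℝ, V) I (extChartAt I p).symm y : _) : V →L[ℝ] V) = _ := h1.mfderiv
  unfold metricInChart
  exact congrArg (fun D : V →L[ℝ] V =>
    (show V →L[ℝ] V →L[ℝ] ℝ from h ((extChartAt I p).symm y)).bilinearComp D D) h3

theorem eventually_transition_comp (p q r : N) {y : V} (hy : y ∈ (extChartAt I p).target)
    (hq : (extChartAt I p).symm y ∈ (extChartAt I q).source) :
    extChartAt I r ∘ (extChartAt I p).symm =ᶠ[𝓝 y]
      (extChartAt I r ∘ (extChartAt I q).symm) ∘ (extChartAt I q ∘ (extChartAt I p).symm) := by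
  have h1 := (continuousAt_extChartAt_symm'' hy).eventually
    ((isOpen_extChartAt_source (I := I) q).mem_nhds hq)
  filter_upwards [h1] with z hz
  simp only [Function.comp_apply]
  rw [(extChartAt I q).left_inv hz]

theorem metricInChart_transition [I.Boundaryless] [IsManifold I 1 N]
    (h : ∀ q : N, TangentSpace I q →L[ℝ] TangentSpace I q →L[ℝ] ℝ) (p q : N) {y : V}
    (hy : y ∈ (extChartAt I p).target) (hq : (extChartAt I p).symm y ∈ (extChartAt I q).source) :
    metricInChart I h p y =
      (metricInChart I h q ((extChartAt I q ∘ (extChartAt I p).symm) y)).bilinearComp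
        (fderiv ℝ (extChartAt I q ∘ (extChartAt I p).symm) y)
        (fderiv ℝ (extChartAt I q ∘ (extChartAt I p).symm) y) := by
  have hz : (extChartAt I q ∘ (extChartAt I p).symm) y ∈ (extChartAt I q).target :=
    (extChartAt I q).map_source hq
  have hx : (extChartAt I q).symm ((extChartAt I q ∘ (extChartAt I p).symm) y) =
    (extChartAt I p).symm y := (extChartAt I q).left_inv hq
  rw [metricInChart_eq h p hy, metricInChart_eq h q hz]
  have h1 := (eventually_transition_comp p q ((extChartAt I p).symm y) hy hq).fderiv_eq (𝕜 := ℝ)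
  rw [fderiv_comp y ?_ ((contDiffAt_transition (k := 1) p q hy hq).differentiableAt
    one_ne_zero)] at h1
  · rw [h1, hx]
    rfl
  · refine (contDiffAt_transition (k := 1) q _ hz ?_).differentiableAt one_ne_zero
    rw [hx]
    exact mem_extChartAt_source _

theorem metricInChart_self [I.Boundaryless] [IsManifold I 1 N]
    (h : ∀ q : N, TangentSpace I q →L[ℝ] TangentSpace I q →L[ℝ] ℝ) (p : N) :
    metricInChart I h p (extChartAt I p p) = (show V →L[ℝ] V →L[ℝ] ℝ from h p) := by
  rw [metricInChart_eq h p (mem_extChartAt_target p)]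
  have h1 := fderivWithin_extChartAt_comp_extChartAt_symm_range (𝕜 := ℝ) (I := I) (x := p)
  rw [I.range_eq_univ, fderivWithin_univ] at h1
  rw [extChartAt_to_inv, h1]
  rfl

theorem christoffel_congr {W : Type*} [NormedAddCommGroup W] [NormedSpace ℝ W]
    {F F' : W → W →L[ℝ] W →L[ℝ] ℝ} {y : W} (hF : F =ᶠ[𝓝 y] F') :
    christoffel F =ᶠ[𝓝 y] christoffel F' := by
  filter_upwards [hF, hF.fderiv (𝕜 := ℝ)] with z h1 h2
  rw [christoffel, christoffel, christoffelLower, christoffelLower, h1, h2]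

theorem coordCurvature_congr {W : Type*} [NormedAddCommGroup W] [NormedSpace ℝ W]
    {F F' : W → W →L[ℝ] W →L[ℝ] ℝ} {y : W} (hF : F =ᶠ[𝓝 y] F') (u v w : W) :
    coordCurvature F y u v w = coordCurvature F' y u v w := by
  have h1 := christoffel_congr hF
  have h2 : ∀ v w, (fun z => christoffel F z v w) =ᶠ[𝓝 y] fun z => christoffel F' z v w :=
    fun v w => h1.mono fun z hz => by simp only [hz]
  rw [coordCurvature, coordCurvature, (h2 v w).fderiv_eq, (h2 u w).fderiv_eq, h1.eq_of_nhds]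

end Charts

/-- With `df = 0` the tensor `A` is zero, and every term contains `A`. -/
theorem obstructionVanishes_of_const {n : ℕ} {M : Type*} [TopologicalSpace M]
    [ChartedSpace (EuclideanSpace ℝ (Fin n)) M]
    (g : ∀ x : M, TangentSpace (𝓡 n) x →L[ℝ] TangentSpace (𝓡 n) x →L[ℝ] ℝ) {f : M → ℝ} {C : ℝ}
    (hf : ∀ x, f x = C) : ObstructionVanishes (𝓡 n) g f := by
  intro p y _ m l j
  have hA : ∀ z u v, coordA (metricInChart (𝓡 n) g p)
      (fun z => f ((extChartAt (𝓡 n) p).symm z)) z u v = 0 := fun z u v => by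
    simp [coordA, hf]
  simp only [coordObstruction, coordCovDeriv, hA]
  simp

/-! ### The base metric in a chart -/

section Base

variable {n : ℕ} {M : Type*} [TopologicalSpace M] [ChartedSpace (EuclideanSpace ℝ (Fin n)) M]
  [IsManifold (𝓡 n) ∞ M]

/-- The differential of the inverse chart is the inverse of the tangent bundle trivialization, so
the coordinate components are the values of `g` on smooth local frame fields. -/
theorem contDiffAt_metricInChart
    (g : Bundle.ContMDiffRiemannianMetric (𝓡 n) ∞ (EuclideanSpace ℝ (Fin n))
      (fun x : M => TangentSpace (𝓡 n) x)) (p : M) {y : EuclideanSpace ℝ (Fin n)}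
    (hy : y ∈ (extChartAt (𝓡 n) p).target) :
    ContDiffAt ℝ ∞ (metricInChart (𝓡 n) g.inner p) y := by
  suffices h : ContDiffOn ℝ ∞ (metricInChart (𝓡 n) g.inner p) (extChartAt (𝓡 n) p).target from
    h.contDiffAt ((isOpen_extChartAt_target p).mem_nhds hy)
  refine contDiffOn_clm_apply.2 fun v => contDiffOn_clm_apply.2 fun w => ?_
  let e := trivializationAt (EuclideanSpace ℝ (Fin n)) (fun x : M => TangentSpace (𝓡 n) x) p
  have hs : ∀ v : EuclideanSpace ℝ (Fin n), ContMDiffOn (𝓡 n) ((𝓡 n).prod (𝓡 n)) ∞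
      (fun x : M => (⟨x, e.symmL ℝ x v⟩ : TangentBundle (𝓡 n) M))
      (extChartAt (𝓡 n) p).source := fun v => by
    have h1 := (e.contMDiffOn_symm (n := ∞) (IB := 𝓡 n)).comp
      (f := fun x : M => (x, v)) (s := (extChartAt (𝓡 n) p).source)
      (contMDiffOn_id.prodMk contMDiffOn_const) fun x hx => by
        rw [Set.mem_preimage, e.mem_target]
        simpa [e] using hx
    refine h1.congr fun x hx => ?_
    rw [extChartAt_source] at hx
    have hb : x ∈ e.baseSet := by simpa [e] using hx
    rw [Function.comp_apply, ← e.mk_symm hb, e.symmL_apply hb]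
  have h1 : ContMDiffOn (𝓡 n) 𝓘(ℝ, ℝ) ∞ (fun x : M => g.inner x (e.symmL ℝ x v) (e.symmL ℝ x w))
      (extChartAt (𝓡 n) p).source := by
    have : ContMDiffOn (𝓡 n) ((𝓡 n).prod 𝓘(ℝ)) ∞ (fun x => Bundle.TotalSpace.mk' ℝ
        (E := Bundle.Trivial M ℝ) x (g.inner x (e.symmL ℝ x v) (e.symmL ℝ x w)))
        (extChartAt (𝓡 n) p).source := by
      apply ContMDiffOn.clm_bundle_apply₂ (F₁ := EuclideanSpace ℝ (Fin n))
        (F₂ := EuclideanSpace ℝ (Fin n))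
      · exact g.contMDiff.contMDiffOn
      · exact hs v
      · exact hs w
    intro x hx
    exact (Bundle.contMDiffWithinAt_totalSpace.1 (this x hx)).2
  have h2 := h1.comp (contMDiffOn_extChartAt_symm p) fun z hz => (extChartAt (𝓡 n) p).map_target hz
  refine (contMDiffOn_iff_contDiffOn.1 h2).congr fun z hz => ?_
  have hz' := (extChartAt (𝓡 n) p).map_target hz
  rw [extChartAt_source] at hz'
  have h3 := TangentBundle.symmL_trivializationAt (𝕜 := ℝ) (I := 𝓡 n) hz'
  rw [(𝓡 n).range_eq_univ, mfderivWithin_univ, (extChartAt (𝓡 n) p).right_inv hz] at h3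
  rw [metricInChart_apply, ← h3]
  rfl

theorem isCoordMetric_metricInChart
    (g : Bundle.ContMDiffRiemannianMetric (𝓡 n) ∞ (EuclideanSpace ℝ (Fin n))
      (fun x : M => TangentSpace (𝓡 n) x))
    {f : M → ℝ} (hf : ContMDiff (𝓡 n) 𝓘(ℝ, ℝ) ∞ f) (hf_pos : ∀ x, 0 < f x) (p : M) :
    IsCoordMetric (extChartAt (𝓡 n) p).target (metricInChart (𝓡 n) g.inner p)
      (fun z => f ((extChartAt (𝓡 n) p).symm z)) where
  isOpen := isOpen_extChartAt_target p
  smooth y hy := contDiffAt_metricInChart g p hy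
  symm y hy v w := by
    rw [metricInChart_apply, metricInChart_apply]
    exact g.symm _ _ _
  pos y hy v hv := by
    rw [metricInChart_apply]
    refine g.pos _ _ fun h => hv ?_
    have h1 := isInvertible_mfderivWithin_extChartAt_symm hy
    rw [(𝓡 n).range_eq_univ, mfderivWithin_univ] at h1
    exact h1.injective (h.trans (map_zero _).symm)
  smooth_fun y hy := by
    have h1 := (hf.contMDiffOn (s := Set.univ)).comp (contMDiffOn_extChartAt_symm p)
      fun z hz => Set.mem_univ _
    exact (contMDiffOn_iff_contDiffOn.1 h1).contDiffAt ((isOpen_extChartAt_target p).mem_nhds hy)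
  pos_fun y hy := hf_pos _

end Base

/-! ### Charts of the tensor bundle and invariance of the Sasaki type form -/

section SasakiTransition

variable {n : ℕ}

/-- Invariance of the rescaled Sasaki type form under a change of coordinates of the base, with
derivative `e` and second derivative `D`. -/
theorem sasakiForm_changeOfCoordinates
    {b : EuclideanSpace ℝ (Fin n) →L[ℝ] EuclideanSpace ℝ (Fin n) →L[ℝ] ℝ} (hb : b.IsInvertible)
    (c : ℝ) {Γ Γ' : EuclideanSpace ℝ (Fin n) →L[ℝ] EuclideanSpace ℝ (Fin n) →L[ℝ]
      EuclideanSpace ℝ (Fin n)}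
    {τ t : EuclideanSpace ℝ (Fin n) →L[ℝ] EuclideanSpace ℝ (Fin n)}
    (e : EuclideanSpace ℝ (Fin n) ≃L[ℝ] EuclideanSpace ℝ (Fin n))
    {D : EuclideanSpace ℝ (Fin n) → EuclideanSpace ℝ (Fin n) →L[ℝ] EuclideanSpace ℝ (Fin n)}
    (hΓ : ∀ u v, e (Γ' u v) = D u v + Γ (e u) (e v)) (ht : ∀ v, t (e v) = e (τ v))
    {ξ η ξ' η' : EuclideanSpace ℝ (Fin n) ×
      (EuclideanSpace ℝ (Fin n) →L[ℝ] EuclideanSpace ℝ (Fin n))}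
    (hξ : ξ'.1 = e ξ.1) (hη : η'.1 = e η.1)
    (hξ2 : ∀ v, ξ'.2 (e v) + t (D ξ.1 v) = D ξ.1 (τ v) + e (ξ.2 v))
    (hη2 : ∀ v, η'.2 (e v) + t (D η.1 v) = D η.1 (τ v) + e (η.2 v)) :
    sasakiForm b c Γ t ξ' η' = sasakiForm (b.bilinearComp (e : _ →L[ℝ] EuclideanSpace ℝ (Fin n))
      (e : _ →L[ℝ] EuclideanSpace ℝ (Fin n))) c Γ' τ ξ η := by
  have key : ∀ ξ ξ' : EuclideanSpace ℝ (Fin n) ×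
      (EuclideanSpace ℝ (Fin n) →L[ℝ] EuclideanSpace ℝ (Fin n)), ξ'.1 = e ξ.1 →
      (∀ v, ξ'.2 (e v) + t (D ξ.1 v) = D ξ.1 (τ v) + e (ξ.2 v)) →
      verticalPart Γ t ξ' = (e : _ →L[ℝ] EuclideanSpace ℝ (Fin n)) ∘L verticalPart Γ' τ ξ ∘L
        -- The vertical part is tensorial: the second derivative terms `D` from the change of fibre
        -- coordinates (`h2`) cancel those from the change of `Γ` (`hΓ`).
        (e.symm : _ →L[ℝ] EuclideanSpace ℝ (Fin n)) := fun ξ ξ' h1 h2 => by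
    ext1 w
    obtain ⟨v, rfl⟩ := e.surjective w
    have h3 := h2 v
    have h4 := congrArg t (hΓ ξ.1 v)
    rw [ht, map_add] at h4
    simp [verticalPart_apply, h1, ht, hΓ]
    linear_combination (norm := module) h3 + h4
  rw [sasakiForm_apply, sasakiForm_apply, key ξ ξ' hξ hξ2, key η η' hη hη2,
    tensorInner_bilinearComp hb, hξ, hη]
  rfl

variable {M : Type*} [TopologicalSpace M] [ChartedSpace (EuclideanSpace ℝ (Fin n)) M]
  [IsManifold (𝓡 n) ∞ M]

theorem mem_extChartAt_T11_target (p : T11 n M) (z : EuclideanSpace ℝ (Fin n) ×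
      (EuclideanSpace ℝ (Fin n) →L[ℝ] EuclideanSpace ℝ (Fin n))) :
    z ∈ (extChartAt (T11Model n) p).target ↔ z.1 ∈ (extChartAt (𝓡 n) p.1).target := by
  rw [FiberBundle.extChartAt_target, Set.mem_prod, Set.mem_inter_iff, Set.mem_preimage,
    hom_trivializationAt_baseSet]
  simp only [TangentBundle.trivializationAt_baseSet, Set.inter_self, Set.mem_univ, and_true]
  refine and_iff_left_of_imp fun h => ?_
  rw [← extChartAt_source (𝓡 n)]
  exact (extChartAt (𝓡 n) p.1).map_target h

/-- The tensor at a point of the bundle, in the coordinates of the chart around that point. -/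
def tensorAt (z : T11 n M) : EuclideanSpace ℝ (Fin n) →L[ℝ] EuclideanSpace ℝ (Fin n) := z.2

theorem extChartAt_T11_apply (p z : T11 n M)
    (hz : z.1 ∈ (extChartAt (𝓡 n) p.1).source) :
    extChartAt (T11Model n) p z = (extChartAt (𝓡 n) p.1 z.1,
      tangentCoordChange (𝓡 n) z.1 p.1 z.1 ∘L
        tensorAt z ∘L tangentCoordChange (𝓡 n) p.1 z.1 z.1) := by
  rw [extChartAt_source] at hz
  rw [FiberBundle.extChartAt]
  have h := (tangentBundleCore (𝓡 n) M).inCoordinates_eq (tangentBundleCore (𝓡 n) M) (x₀ := p.1)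
    (x := z.1) (y₀ := p.1) (y := z.1) (σ := RingHom.id ℝ) z.2 hz hz
  simp only [PartialEquiv.coe_trans, Function.comp_apply, PartialEquiv.prod_coe,
    PartialEquiv.refl_coe, id_eq]
  have h1 := hom_trivializationAt_apply (RingHom.id ℝ) (F₁ := EuclideanSpace ℝ (Fin n))
    (E₁ := fun x : M => TangentSpace (𝓡 n) x) (F₂ := EuclideanSpace ℝ (Fin n))
    (E₂ := fun x : M => TangentSpace (𝓡 n) x) p.1 z
  refine Prod.ext ?_ ?_
  · exact congrArg (fun w => extChartAt (𝓡 n) p.1 w.1) h1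
  · exact (congrArg Prod.snd h1).trans h

theorem fderiv_transition (x q : M) {y : EuclideanSpace ℝ (Fin n)}
    (hy : y ∈ (extChartAt (𝓡 n) x).target) :
    fderiv ℝ (extChartAt (𝓡 n) q ∘ (extChartAt (𝓡 n) x).symm) y =
      tangentCoordChange (𝓡 n) x q ((extChartAt (𝓡 n) x).symm y) := by
  rw [tangentCoordChange_def, (𝓡 n).range_eq_univ, fderivWithin_univ,
    (extChartAt (𝓡 n) x).right_inv hy]

theorem isInvertible_fderiv_transition (x q : M) {y : EuclideanSpace ℝ (Fin n)}
    (hy : y ∈ (extChartAt (𝓡 n) x).target)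
    (hq : (extChartAt (𝓡 n) x).symm y ∈ (extChartAt (𝓡 n) q).source) :
    (fderiv ℝ (extChartAt (𝓡 n) q ∘ (extChartAt (𝓡 n) x).symm) y).IsInvertible := by
  have hx := (extChartAt (𝓡 n) x).map_target hy
  rw [fderiv_transition x q hy]
  refine ContinuousLinearMap.IsInvertible.of_inverse
    (g := tangentCoordChange (𝓡 n) q x ((extChartAt (𝓡 n) x).symm y)) ?_ ?_
  · ext1 v
    rw [ContinuousLinearMap.comp_apply, tangentCoordChange_comp ⟨⟨hq, hx⟩, hq⟩,
      tangentCoordChange_self hq]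
    rfl
  · ext1 v
    rw [ContinuousLinearMap.comp_apply, tangentCoordChange_comp ⟨⟨hx, hq⟩, hx⟩,
      tangentCoordChange_self hx]
    rfl

theorem fst_mem_source_of_mem_T11_source (p : T11 n M) {z : T11 n M}
    (hz : z ∈ (extChartAt (T11Model n) p).source) : z.1 ∈ (extChartAt (𝓡 n) p.1).source := by
  rw [FiberBundle.extChartAt, PartialEquiv.trans_source] at hz
  have h1 := congrArg Prod.fst (hom_trivializationAt_apply (RingHom.id ℝ)
    (F₁ := EuclideanSpace ℝ (Fin n)) (E₁ := fun x : M => TangentSpace (𝓡 n) x)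
    (F₂ := EuclideanSpace ℝ (Fin n)) (E₂ := fun x : M => TangentSpace (𝓡 n) x) p.1 z)
  exact Eq.subst (motive := fun x => x ∈ (extChartAt (𝓡 n) p.1).source) h1 hz.2.1

theorem extChartAt_T11_symm_fst (p : T11 n M) {w : EuclideanSpace ℝ (Fin n) ×
      (EuclideanSpace ℝ (Fin n) →L[ℝ] EuclideanSpace ℝ (Fin n))}
    (hw : w.1 ∈ (extChartAt (𝓡 n) p.1).target) :
    ((extChartAt (T11Model n) p).symm w).1 = (extChartAt (𝓡 n) p.1).symm w.1 ∧
      (tangentCoordChange (𝓡 n) ((extChartAt (𝓡 n) p.1).symm w.1) p.1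
        ((extChartAt (𝓡 n) p.1).symm w.1) ∘L
        tensorAt ((extChartAt (T11Model n) p).symm w) ∘L
          tangentCoordChange (𝓡 n) p.1 ((extChartAt (𝓡 n) p.1).symm w.1)
            ((extChartAt (𝓡 n) p.1).symm w.1)) = w.2 := by
  have hwt := (mem_extChartAt_T11_target p w).2 hw
  have hs : ((extChartAt (T11Model n) p).symm w).1 ∈ (extChartAt (𝓡 n) p.1).source :=
    fst_mem_source_of_mem_T11_source p ((extChartAt (T11Model n) p).map_target hwt)
  have h1 := extChartAt_T11_apply p _ hs
  rw [(extChartAt (T11Model n) p).right_inv hwt] at h1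
  have h2 : ((extChartAt (T11Model n) p).symm w).1 = (extChartAt (𝓡 n) p.1).symm w.1 := by
    rw [congrArg Prod.fst h1, (extChartAt (𝓡 n) p.1).left_inv hs]
  refine ⟨h2, ?_⟩
  rw [← h2]
  exact (congrArg Prod.snd h1).symm

/-- A tensor changes by conjugation with the Jacobian. Stated as an intertwining relation, without
the inverse Jacobian, it can be differentiated directly. -/
theorem T11_transition (p q : T11 n M) {w : EuclideanSpace ℝ (Fin n) ×
      (EuclideanSpace ℝ (Fin n) →L[ℝ] EuclideanSpace ℝ (Fin n))}
    (hw : w.1 ∈ (extChartAt (𝓡 n) p.1).target)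
    (hq : (extChartAt (𝓡 n) p.1).symm w.1 ∈ (extChartAt (𝓡 n) q.1).source) :
    ((extChartAt (T11Model n) q ∘ (extChartAt (T11Model n) p).symm) w).1 =
        (extChartAt (𝓡 n) q.1 ∘ (extChartAt (𝓡 n) p.1).symm) w.1 ∧
      ∀ v, ((extChartAt (T11Model n) q ∘ (extChartAt (T11Model n) p).symm) w).2
          (fderiv ℝ (extChartAt (𝓡 n) q.1 ∘ (extChartAt (𝓡 n) p.1).symm) w.1 v) =
        fderiv ℝ (extChartAt (𝓡 n) q.1 ∘ (extChartAt (𝓡 n) p.1).symm) w.1 (w.2 v) := by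
  obtain ⟨h1, h2⟩ := extChartAt_T11_symm_fst p hw
  have hp := (extChartAt (𝓡 n) p.1).map_target hw
  have h3 := extChartAt_T11_apply q ((extChartAt (T11Model n) p).symm w) (by rwa [h1])
  rw [Function.comp_apply, h3]
  refine ⟨by rw [h1]; rfl, fun v => ?_⟩
  rw [fderiv_transition _ _ hw, ← h2, h1]
  simp only [ContinuousLinearMap.comp_apply]
  rw [tangentCoordChange_comp ⟨⟨hp, hq⟩, mem_extChartAt_source _⟩,
    tangentCoordChange_comp ⟨⟨mem_extChartAt_source _, hp⟩, hq⟩]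

end SasakiTransition

/-! ### The Sasaki type metric in bundle charts, and the theorem -/

section SasakiBundle

variable {n : ℕ} {M : Type*} [TopologicalSpace M] [ChartedSpace (EuclideanSpace ℝ (Fin n)) M]
  [IsManifold (𝓡 n) ∞ M]

theorem extChartAt_T11_self (q : T11 n M) :
    extChartAt (T11Model n) q q = (extChartAt (𝓡 n) q.1 q.1, tensorAt q) := by
  rw [extChartAt_T11_apply q q (mem_extChartAt_source _)]
  refine Prod.ext rfl ?_
  ext1 v
  simp only [ContinuousLinearMap.comp_apply]
  rw [tangentCoordChange_self (mem_extChartAt_source _),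
    tangentCoordChange_self (mem_extChartAt_source _)]

theorem sasaki_eq (g : ∀ x : M, TangentSpace (𝓡 n) x →L[ℝ] TangentSpace (𝓡 n) x →L[ℝ] ℝ)
    (f : M → ℝ) (q : T11 n M) :
    sasaki g f q = sasakiForm (metricInChart (𝓡 n) g q.1 (extChartAt (𝓡 n) q.1 q.1)) (f q.1)
      (christoffelAt g q.1) (tensorAt q) := by
  rw [metricInChart_self]
  rfl

/-- The coordinate expression of the rescaled Sasaki type metric. -/
theorem metricInChart_sasaki
    (g : Bundle.ContMDiffRiemannianMetric (𝓡 n) ∞ (EuclideanSpace ℝ (Fin n))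
      (fun x : M => TangentSpace (𝓡 n) x))
    {f : M → ℝ} (hf : ContMDiff (𝓡 n) 𝓘(ℝ, ℝ) ∞ f) (hf_pos : ∀ x, 0 < f x) (p : T11 n M)
    {w : EuclideanSpace ℝ (Fin n) × (EuclideanSpace ℝ (Fin n) →L[ℝ] EuclideanSpace ℝ (Fin n))}
    (hw : w.1 ∈ (extChartAt (𝓡 n) p.1).target) :
    metricInChart (T11Model n) (sasaki g.inner f) p w =
      coordSasaki (metricInChart (𝓡 n) g.inner p.1)
        (fun z => f ((extChartAt (𝓡 n) p.1).symm z)) w := by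
  have hwt := (mem_extChartAt_T11_target p w).2 hw
  rw [metricInChart_eq _ p hwt]
  set q := (extChartAt (T11Model n) p).symm w with hq
  have hq1 : q.1 = (extChartAt (𝓡 n) p.1).symm w.1 := (extChartAt_T11_symm_fst p hw).1
  set ψ := extChartAt (𝓡 n) q.1 ∘ (extChartAt (𝓡 n) p.1).symm with hψ
  set Φ := extChartAt (T11Model n) q ∘ (extChartAt (T11Model n) p).symm with hΦ
  have hqs : (extChartAt (𝓡 n) p.1).symm w.1 ∈ (extChartAt (𝓡 n) q.1).source := by
    rw [← hq1]; exact mem_extChartAt_source _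
  have hψw : ψ w.1 = extChartAt (𝓡 n) q.1 q.1 := by rw [hψ, Function.comp_apply, ← hq1]
  have hΦw : Φ w = (extChartAt (𝓡 n) q.1 q.1, tensorAt q) := by
    rw [hΦ, Function.comp_apply, ← hq, extChartAt_T11_self]
  have hψs : ContDiffAt ℝ ∞ ψ w.1 := contDiffAt_transition p.1 q.1 hw hqs
  have hΦd : HasFDerivAt Φ (fderiv ℝ Φ w) w :=
    ((contDiffAt_transition (k := 1) p q hwt (mem_extChartAt_source _)).differentiableAt
      one_ne_zero).hasFDerivAt
  have hnhds : ∀ᶠ y in 𝓝 w.1, y ∈ (extChartAt (𝓡 n) p.1).target ∧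
      (extChartAt (𝓡 n) p.1).symm y ∈ (extChartAt (𝓡 n) q.1).source :=
    Filter.Eventually.and ((isOpen_extChartAt_target p.1).mem_nhds hw)
      ((continuousAt_extChartAt_symm'' hw).eventually
        ((isOpen_extChartAt_source q.1).mem_nhds hqs))
  have hnhds' : ∀ᶠ z in 𝓝 w, (Φ z).1 = ψ z.1 ∧
      ∀ v, (Φ z).2 (fderiv ℝ ψ z.1 v) = fderiv ℝ ψ z.1 (z.2 v) :=
    (continuousAt_fst.eventually hnhds).mono fun z hz => T11_transition p q hz.1 hz.2
  obtain ⟨e, he⟩ := isInvertible_fderiv_transition p.1 q.1 hw hqs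
  have he' : ∀ v, e v = fderiv ℝ ψ w.1 v := fun v => congrArg (fun L => L v) he
  have hD : HasFDerivAt (fderiv ℝ ψ) (fderiv ℝ (fderiv ℝ ψ) w.1) w.1 :=
    ((hψs.fderiv_right (m := ∞) (by simp)).differentiableAt (by simp)).hasFDerivAt
  have hDw : HasFDerivAt (fun z : EuclideanSpace ℝ (Fin n) ×
      (EuclideanSpace ℝ (Fin n) →L[ℝ] EuclideanSpace ℝ (Fin n)) => fderiv ℝ ψ z.1) _ w :=
    hD.comp w hasFDerivAt_fst
  have hfst : ∀ ξ, (fderiv ℝ Φ w ξ).1 = e ξ.1 := fun ξ => by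
    have h1 : HasFDerivAt (fun z => (Φ z).1) _ w := hasFDerivAt_fst.comp w hΦd
    have h2 : HasFDerivAt (fun z : EuclideanSpace ℝ (Fin n) ×
      (EuclideanSpace ℝ (Fin n) →L[ℝ] EuclideanSpace ℝ (Fin n)) => ψ z.1) _ w :=
      (hψs.differentiableAt (by simp)).hasFDerivAt.comp w hasFDerivAt_fst
    rw [he']
    exact congrArg (fun L => L ξ) (h1.unique (h2.congr_of_eventuallyEq
      (hnhds'.mono fun z hz => hz.1)))
  -- The derivative of the intertwining relation `t' ∘ Dψ = Dψ ∘ t` in the direction `ξ`.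
  have hsnd : ∀ ξ v, (fderiv ℝ Φ w ξ).2 (e v) + tensorAt q (fderiv ℝ (fderiv ℝ ψ) w.1 ξ.1 v) =
      fderiv ℝ (fderiv ℝ ψ) w.1 ξ.1 (w.2 v) + e (ξ.2 v) := fun ξ v => by
    have h0 : HasFDerivAt (fun z => (Φ z).2) _ w := hasFDerivAt_snd.comp w hΦd
    have h1 : HasFDerivAt (fun z => (Φ z).2 (fderiv ℝ ψ z.1 v)) _ w :=
      h0.clm_apply (hDw.clm_apply (hasFDerivAt_const v w))
    have h2 : HasFDerivAt (fun z : EuclideanSpace ℝ (Fin n) ×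
      (EuclideanSpace ℝ (Fin n) →L[ℝ] EuclideanSpace ℝ (Fin n)) => fderiv ℝ ψ z.1 (z.2 v)) _ w :=
      hDw.clm_apply (hasFDerivAt_snd.clm_apply (hasFDerivAt_const v w))
    have h3 := congrArg (fun L => L ξ) (h1.unique (h2.congr_of_eventuallyEq
      (hnhds'.mono fun z hz => hz.2 v)))
    simp [hΦw] at h3
    rw [he', he', add_comm, h3, add_comm]
  have hψt : ψ w.1 ∈ (extChartAt (𝓡 n) q.1).target := (extChartAt (𝓡 n) q.1).map_source hqs
  have hcm := isCoordMetric_metricInChart g hf hf_pos q.1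
  have hΓ : ∀ u v, e (christoffel (metricInChart (𝓡 n) g.inner p.1) w.1 u v) =
      fderiv ℝ (fderiv ℝ ψ) w.1 u v + christoffelAt g.inner q.1 (e u) (e v) := fun u v => by
    rw [he', he', he', christoffelAt, ← hψw]
    refine christoffel_changeOfCoordinates (hψs.of_le ENat.LEInfty.out) ?_
      (hcm.isInvertible hψt) ((hcm.smooth _ hψt).of_le ENat.LEInfty.out)
      (hcm.eventually_symm hψt)
      (hnhds.mono fun y hy => metricInChart_transition g.inner p.1 q.1 hy.1 hy.2) u v
    rw [← he]
    exact e.injective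
  have ht : ∀ v, tensorAt q (e v) = e (w.2 v) := fun v => by
    have h1 := hnhds'.self_of_nhds.2 v
    rw [hΦw] at h1
    rw [he', he']
    exact h1
  refine ContinuousLinearMap.ext fun ξ => ContinuousLinearMap.ext fun η => ?_
  have hS := sasakiForm_changeOfCoordinates (hcm.isInvertible (hψw ▸ hψt)) (f q.1) e
    (D := fun u => fderiv ℝ (fderiv ℝ ψ) w.1 u) hΓ ht (hfst ξ) (hfst η) (hsnd ξ) (hsnd η)
  have hb : metricInChart (𝓡 n) g.inner p.1 w.1 =
      (metricInChart (𝓡 n) g.inner q.1 (extChartAt (𝓡 n) q.1 q.1)).bilinearComp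
        (e : _ →L[ℝ] EuclideanSpace ℝ (Fin n)) (e : _ →L[ℝ] EuclideanSpace ℝ (Fin n)) := by
    rw [← hψw, he]
    exact metricInChart_transition g.inner p.1 q.1 hw hqs
  rw [← hb, hq1] at hS
  rw [coordSasaki, ← hS, ← hq1, ContinuousLinearMap.bilinearComp_apply, sasaki_eq]

theorem isLocallyFlat_sasaki_iff
    (g : Bundle.ContMDiffRiemannianMetric (𝓡 n) ∞ (EuclideanSpace ℝ (Fin n))
      (fun x : M => TangentSpace (𝓡 n) x))
    {f : M → ℝ} (hf : ContMDiff (𝓡 n) 𝓘(ℝ, ℝ) ∞ f) (hf_pos : ∀ x, 0 < f x) :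
    IsLocallyFlat (T11Model n) (sasaki g.inner f) ↔
      IsLocallyFlat (𝓡 n) g.inner ∧ ObstructionVanishes (𝓡 n) g.inner f := by
  have h1 : ∀ p : T11 n M,
      (∀ z ∈ (extChartAt (T11Model n) p).target, ∀ ξ η ζ,
        coordCurvature (metricInChart (T11Model n) (sasaki g.inner f) p) z ξ η ζ = 0) ↔
      (∀ y ∈ (extChartAt (𝓡 n) p.1).target, ∀ u v w,
        coordCurvature (metricInChart (𝓡 n) g.inner p.1) y u v w = 0) ∧
      ∀ y ∈ (extChartAt (𝓡 n) p.1).target, ∀ u v w, coordObstruction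
        (metricInChart (𝓡 n) g.inner p.1) (fun z => f ((extChartAt (𝓡 n) p.1).symm z)) y u v w
          = 0 := fun p => by
    have hcm := isCoordMetric_metricInChart g hf hf_pos p.1
    rw [← hcm.coordSasaki_flat_iff]
    refine forall_congr' fun z => ?_
    rw [mem_extChartAt_T11_target]
    refine forall_congr' fun hz => forall_congr' fun ξ => forall_congr' fun η =>
      forall_congr' fun ζ => ?_
    rw [coordCurvature_congr ((continuousAt_fst.eventually (hcm.eventually_mem hz)).mono
      fun w hw => metricInChart_sasaki g hf hf_pos p hw)]
  constructor
  · intro h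
    -- The bundle chart depends only on the base point, so the chart around the zero tensor at `x`
    -- covers the whole chart of `M` around `x`.
    exact ⟨fun x => ((h1 ⟨x, 0⟩).1 (h ⟨x, 0⟩)).1, fun x => ((h1 ⟨x, 0⟩).1 (h ⟨x, 0⟩)).2⟩
  · rintro ⟨hR, hO⟩ p
    exact (h1 p).2 ⟨hR p.1, hO p.1⟩

end SasakiBundle

end RescaledSasaki

end

theorem mainTheorem4 {n : ℕ} {M : Type*} [TopologicalSpace M]
    [ChartedSpace (EuclideanSpace ℝ (Fin n)) M] [IsManifold (𝓡 n) ∞ M]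
    (g : Bundle.ContMDiffRiemannianMetric (𝓡 n) ∞ (EuclideanSpace ℝ (Fin n))
      (fun x : M => TangentSpace (𝓡 n) x))
    (f : M → ℝ) (hf : ContMDiff (𝓡 n) 𝓘(ℝ, ℝ) ∞ f) (hf_pos : ∀ x, 0 < f x) :
    (RescaledSasaki.IsLocallyFlat (RescaledSasaki.T11Model n) (RescaledSasaki.sasaki g.inner f) ↔
      RescaledSasaki.IsLocallyFlat (𝓡 n) g.inner ∧
        RescaledSasaki.ObstructionVanishes (𝓡 n) g.inner f) ∧
    ((∃ C : ℝ, ∀ x, f x = C) →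
      (RescaledSasaki.IsLocallyFlat (RescaledSasaki.T11Model n) (RescaledSasaki.sasaki g.inner f) ↔
        RescaledSasaki.IsLocallyFlat (𝓡 n) g.inner)) := by
  have h := RescaledSasaki.isLocallyFlat_sasaki_iff g hf hf_pos
  refine ⟨h, fun ⟨C, hC⟩ => ?_⟩
  rw [h]
  exact and_iff_left (RescaledSasaki.obstructionVanishes_of_const g.inner hC)
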